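/- Let $d\ge 2$ and let $(\mathbf X,Y),(\mathbf X_1,Y_1),(\mathbf X_2,Y_2),\dots$ be i.i.d. $[0,1]^d\times\mathbb R$-valued random pairs with $\mathbb E Y^2<\infty$. Let $r(\mathbf x)=\mathbb E[Y\mid\mathbf X=\mathbf x]$, and let $\mathcal S\subseteq\{1,\dots,d\}$ with $S=\operatorname{Card}\mathcal S\ge 2$ be such that $r(\mathbf x)=r^\star(\mathbf x_{\mathcal S})$ for almost every $\mathbf x\in[0,1]^d$ (with respect to the law of $\mathbf X$), where $\mathbf x_{\mathcal S}=(x^{(j)}:j\in\mathcal S)$ and $r^\star:[0,1]^S\to\mathbb R$; below, $r$ in the supremum is the version $\mathbf x\mapsto r^\star(\mathbf x_{\mathcal S})$. For each $n\ge1$ let $k_n\ge 2$ be a deterministic real number and let $p_{n1},\dots,p_{nd}\in(0,1)$ satisfy $\sum_{j=1}^d p_{nj}=1$. A random tree is built from the root cell $[0,1]^d$ by repeating $\lceil\log_2 k_n\rceil$ times: in each current cell, draw a coordinate, equal to $j$ with probability $p_{nj}$, and cut the cell at the midpoint of its $j$-th side. The draws at different nodes are independent of each other; together they form $\Theta$,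 which is independent of $\mathbf X$ and of the sample. Let $A_n(\mathbf x,\Theta)$ be the terminal cell that contains $\mathbf x$, let $r_n(\mathbf x,\Theta)$ be the average of those $Y_i$, $1\le i\le n$, for which $\mathbf X_i\in A_n(\mathbf x,\Theta)$ (and $0$ if there are none), and let $\bar r_n(\mathbf x)=\mathbb E_\Theta[r_n(\mathbf x,\Theta)]$, where $\mathbb E_\Theta$ is the expectation over $\Theta$ only, the sample and $\mathbf x$ being fixed. Assume that $\mathbf X$ is uniformly distributed on $[0,1]^d$, that $r^\star$ is $L$-Lipschitz on $[0,1]^S$ for the Euclidean metric, that $\mathbb V[Y\mid\mathbf X=\mathbf x]\le\sigma^2$ for (almost) every $\mathbf x$, for some constant $\sigma^2>0$, and that $p_{nj}=\frac1S(1+\xi_{nj})$ for $j\in\mathcal S$, where $\xi_{nj}\to0$ as $n\to\infty$ for every $j\in\mathcal S$. Put $\gamma_n=\min_{j\in\mathcal S}\xi_{nj}$, $$1+\xi_n=\prod_{j\in\mathcal S}\Big[(1+\xi_{nj})^{-1}\Big(1-\frac{\xi_{nj}}{S-1}\Big)^{-1}\Big]^{1/(2d)},\qquad C=\frac{288}{\pi}\Big(\frac{\pi\log2}{16}\Big)^{S/(2d)},$$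 $$\Xi_n=C\sigma^2\Big(\frac{S^2}{S-1}\Big)^{S/(2d)}(1+\xi_n)+2e^{-1}\sup_{\mathbf x\in[0,1]^d}r^2(\mathbf x).$$ Then, for every $n\ge1$, $(\bar r_n(\mathbf X)-r(\mathbf X))^2$ is integrable and $$\mathbb E\big[\bar r_n(\mathbf X)-r(\mathbf X)\big]^2\le\Xi_n\frac{k_n}{n}+\frac{2SL^2}{k_n^{\frac{0.75}{S\log2}(1+\gamma_n)}}.$$ Moreover the sequence $(\xi_n)$, which depends on the sequences $(\xi_{nj})$, $j\in\mathcal S$, only (besides $S$ and $d$), tends to $0$ as $n\to\infty$. -/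

import Mathlib

open MeasureTheory ProbabilityTheory Filter Topology
open scoped NNReal

noncomputable section

namespace RandomForest

/-- The cube `[0,1]^ι`, as a subset of the Euclidean space `ℝ^ι`. -/
def unitCube (ι : Type*) : Set (EuclideanSpace ℝ ι) :=
  {x | ∀ j, x j ∈ Set.Icc (0 : ℝ) 1}

/-- The subvector `x_S = (x_j : j ∈ S)` of the strong coordinates. -/
def strongPart {d : ℕ} (S : Finset (Fin d)) (x : EuclideanSpace ℝ (Fin d)) :
    EuclideanSpace ℝ S :=
  WithLp.toLp 2 (fun j : S => x j)

/-- A rectangle with lower corner `lo` and upper corner `hi`. -/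
structure Box (d : ℕ) where
  lo : Fin d → ℝ
  hi : Fin d → ℝ

namespace Box

variable {d : ℕ}

/-- The root rectangle, with corners `(0,…,0)` and `(1,…,1)`. -/
def root (d : ℕ) : Box d := ⟨fun _ => 0, fun _ => 1⟩

/-- The midpoint of the `j`-th side. -/
def mid (B : Box d) (j : Fin d) : ℝ := (B.lo j + B.hi j) / 2

/-- The lower half of `B`, after a cut at the midpoint of side `j`. -/
def lower (B : Box d) (j : Fin d) : Box d := ⟨B.lo, Function.update B.hi j (B.mid j)⟩

/-- The upper half of `B`, after a cut at the midpoint of side `j`. -/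
def upper (B : Box d) (j : Fin d) : Box d := ⟨Function.update B.lo j (B.mid j), B.hi⟩

/-- The points of a rectangle. Sides are half-open on the right, except that the sides that reach
the face `y_j = 1` of the unit cube are closed there: so the two halves of a cell are disjoint with
union the cell, and the root is all of `[0,1]^d`. -/
def toSet (B : Box d) : Set (EuclideanSpace ℝ (Fin d)) :=
  {y | ∀ j, B.lo j ≤ y j ∧ (y j < B.hi j ∨ (y j = 1 ∧ B.hi j = 1))}

end Box

/-- The value of the randomizing variable `Θ`: a complete binary tree of depth `m`, each internal
node of which carries the coordinate along which its cell is cut. -/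
inductive SplitTree (d : ℕ) : ℕ → Type
  | leaf : SplitTree d 0
  | node {m : ℕ} (j : Fin d) (l r : SplitTree d m) : SplitTree d (m + 1)

instance (d m : ℕ) : MeasurableSpace (SplitTree d m) := ⊤

/-- The law of `Θ`: at each node the coordinate to cut is drawn from `p`, independently of the
draws at all other nodes. -/
def treeLaw {d : ℕ} (p : PMF (Fin d)) : (m : ℕ) → PMF (SplitTree d m)
  | 0 => PMF.pure SplitTree.leaf
  | m + 1 =>
    p.bind fun j => (treeLaw p m).bind fun l => (treeLaw p m).bind fun r =>
      PMF.pure (SplitTree.node j l r)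

/-- The terminal cell that contains `x` when the rectangle `B` is cut successively, at midpoints,
as the tree prescribes. -/
def SplitTree.cellIn {d : ℕ} :
    {m : ℕ} → SplitTree d m → Box d → EuclideanSpace ℝ (Fin d) → Set (EuclideanSpace ℝ (Fin d))
  | _, .leaf, B, _ => B.toSet
  | _, .node j l r, B, x =>
    if x j < B.mid j then l.cellIn (B.lower j) x else r.cellIn (B.upper j) x

/-- `A_n(x, Θ)`: the terminal cell that contains `x`, starting from the root `[0,1]^d`. -/
def SplitTree.cell {d m : ℕ} (θ : SplitTree d m) (x : EuclideanSpace ℝ (Fin d)) :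
    Set (EuclideanSpace ℝ (Fin d)) :=
  θ.cellIn (Box.root d) x

/-- `N_n(x, Θ)`: the number of data points in the cell of `x`. -/
def cellCount {d m n : ℕ} (θ : SplitTree d m) (xs : Fin n → EuclideanSpace ℝ (Fin d))
    (x : EuclideanSpace ℝ (Fin d)) : ℝ :=
  ∑ i, (θ.cell x).indicator (fun _ => (1 : ℝ)) (xs i)

open Classical in
/-- `r_n(x, Θ)`: the average of the `Y_i` whose `X_i` fall in the cell of `x`, and `0` if there are
none. -/
def treeEstimate {d m n : ℕ} (θ : SplitTree d m) (xs : Fin n → EuclideanSpace ℝ (Fin d))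
    (ys : Fin n → ℝ) (x : EuclideanSpace ℝ (Fin d)) : ℝ :=
  if cellCount θ xs x ≠ 0 then
    (∑ i, (θ.cell x).indicator (fun _ => ys i) (xs i)) / cellCount θ xs x
  else 0

/-- `⌈log₂ k⌉`, the number of times that the cutting procedure is repeated. -/
def depth (k : ℝ) : ℕ := ⌈Real.logb 2 k⌉₊

/-- The forest estimate `E_Θ [r_n(x, Θ)]`. As `Θ` is independent of `X` and of the sample, `E_Θ` is
the integral with respect to the law of `Θ`, the sample and `x` being fixed. -/
def forestEstimate {d n : ℕ} (p : PMF (Fin d)) (k : ℝ) (xs : Fin n → EuclideanSpace ℝ (Fin d))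
    (ys : Fin n → ℝ) (x : EuclideanSpace ℝ (Fin d)) : ℝ :=
  ∫ θ, treeEstimate θ xs ys x ∂(treeLaw p (depth k)).toMeasure

/-- `C = (288/π) (π log 2 / 16)^{S/(2d)}`. -/
def constC (s d : ℕ) : ℝ :=
  288 / Real.pi * (Real.pi * Real.log 2 / 16) ^ ((s : ℝ) / (2 * d))

/-- The number `ξ_n`, a function of the numbers `ξ_{nj}`, `j ∈ S`, given by
`1 + ξ_n = ∏_{j ∈ S} [(1 + ξ_{nj})⁻¹ (1 - ξ_{nj}/(S-1))⁻¹]^{1/(2d)}`. -/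
def xiBar {d : ℕ} (S : Finset (Fin d)) (ξ : Fin d → ℝ) : ℝ :=
  (∏ j ∈ S, ((1 + ξ j)⁻¹ * (1 - ξ j / ((S.card : ℝ) - 1))⁻¹) ^ (1 / (2 * (d : ℝ)))) - 1

/-- `γ_n = min_{j ∈ S} ξ_{nj}`. -/
def gammaMin {d : ℕ} (S : Finset (Fin d)) (ξ : Fin d → ℝ) : ℝ := ⨅ j : S, ξ j

/-- `sup_{x ∈ [0,1]^d} r(x)²` for the version `r(x) = r*(x_S)` of the regression function. -/
def supSq {d : ℕ} (S : Finset (Fin d)) (rstar : EuclideanSpace ℝ S → ℝ) : ℝ :=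
  ⨆ x : unitCube (Fin d), rstar (strongPart S x) ^ 2

/-- `Ξ_n = C σ² (S²/(S-1))^{S/(2d)} (1 + ξ_n) + 2 e^{-1} sup_{x ∈ [0,1]^d} r(x)²`. -/
def bigXi {d : ℕ} (S : Finset (Fin d)) (rstar : EuclideanSpace ℝ S → ℝ) (σ : ℝ) (ξ : Fin d → ℝ) :
    ℝ :=
  constC S.card d * σ ^ 2 *
      ((S.card : ℝ) ^ 2 / ((S.card : ℝ) - 1)) ^ ((S.card : ℝ) / (2 * d)) * (1 + xiBar S ξ)
    + 2 * Real.exp (-1) * supSq S rstar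

end RandomForest

end

open RandomForest

/-! Since the query point `X` is independent of the sample, Tonelli's theorem reduces the risk to a
bound that is uniform over fixed points `x` of the cube. The forest is a convex combination of
trees, so by Jensen its squared error is at most the `Θ`-average of the squared errors of single
trees. No variance reduction from averaging is needed, because the constant in `Ξ_n` already absorbs
the variance of one tree.

Each cut halves one side, so every terminal cell has volume exactly `l = 2^(-m)`, where `m = ⌈log₂
k⌉`, and the number `N` of sample points in the cell of `x` is binomial with parameters `n` and `l`,
whatever the tree. If `N > 0`, the error is an average of centred residuals plus an average of the
increments of `r` over the cell; if `N = 0`, it is `-r(x)`. Three estimates follow.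

Variance: the cross terms vanish, and size-biasing the binomial law gives at most `2σ²/((n+1)l)`
(`integral_sq_sum_div_count_le`). As `2^m ≤ 2k`, twice this is at most `8σ²k/n`, and
`eight_le_variance_constant` bounds 8 by the constant in `Ξ_n`.

Bias: along the path to `x`, side `j` is halved with probability `p_j` at each level, so its mean
square is `(1 - 3p_j/4)^m` (`sum_treeWeight_side_sq`), which is at most `k^(-0.75 p_j / log 2)`.

Empty cell: it has probability `(1-l)^n ≤ exp(-n/(2k)) ≤ 2e⁻¹k/n`, by the inequality `t e^(-t) ≤
e⁻¹`. -/

namespace RandomForest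

/-! ### The geometry of the cells -/

section Geometry

variable {d : ℕ}

/-- The terminal rectangle that contains `x`. -/
noncomputable def SplitTree.boxIn :
    {m : ℕ} → SplitTree d m → Box d → EuclideanSpace ℝ (Fin d) → Box d
  | _, .leaf, B, _ => B
  | _, .node j l r, B, x =>
    if x j < B.mid j then l.boxIn (B.lower j) x else r.boxIn (B.upper j) x

theorem SplitTree.cellIn_eq_toSet {m : ℕ} (θ : SplitTree d m) (B : Box d)
    (x : EuclideanSpace ℝ (Fin d)) : θ.cellIn B x = (θ.boxIn B x).toSet := by
  induction θ generalizing B with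
  | leaf => rfl
  | node j l r ihl ihr =>
    simp only [cellIn, boxIn]
    split_ifs
    · exact ihl _
    · exact ihr _

/-- A predicate on rectangles that passes to both halves passes to the terminal rectangle. -/
theorem SplitTree.boxIn_induction {m : ℕ} (θ : SplitTree d m) (x : EuclideanSpace ℝ (Fin d))
    (Q : Box d → Prop) (hl : ∀ B j, Q B → x j < B.mid j → Q (B.lower j))
    (hu : ∀ B j, Q B → ¬ x j < B.mid j → Q (B.upper j)) (B : Box d) (hB : Q B) :
    Q (θ.boxIn B x) := by
  induction θ generalizing B with
  | leaf => exact hB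
  | node j l r ihl ihr =>
    simp only [boxIn]
    split_ifs with h
    · exact ihl _ (hl _ _ hB h)
    · exact ihr _ (hu _ _ hB h)

namespace Box

theorem lower_side (B : Box d) (j i : Fin d) :
    (B.lower j).hi i - (B.lower j).lo i = (if i = j then 1 / 2 else 1) * (B.hi i - B.lo i) := by
  by_cases h : i = j
  · subst h
    simp only [lower, mid, Function.update_self, if_true]
    ring
  · simp [lower, h]

theorem upper_side (B : Box d) (j i : Fin d) :
    (B.upper j).hi i - (B.upper j).lo i = (if i = j then 1 / 2 else 1) * (B.hi i - B.lo i) := by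
  by_cases h : i = j
  · subst h
    simp only [upper, mid, Function.update_self, if_true]
    ring
  · simp [upper, h]

theorem prod_half (j : Fin d) : ∏ i : Fin d, (if i = j then (1 / 2 : ℝ) else 1) = 1 / 2 := by
  simp

theorem mem_lower {B : Box d} {j : Fin d} {x : EuclideanSpace ℝ (Fin d)} (hx : x ∈ B.toSet)
    (h : x j < B.mid j) : x ∈ (B.lower j).toSet := by
  intro i
  by_cases hi : i = j
  · subst hi
    exact ⟨(hx i).1, Or.inl (by simpa [lower] using h)⟩
  · simpa [lower, hi] using hx i

theorem mem_upper {B : Box d} {j : Fin d} {x : EuclideanSpace ℝ (Fin d)} (hx : x ∈ B.toSet)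
    (h : ¬ x j < B.mid j) : x ∈ (B.upper j).toSet := by
  intro i
  by_cases hi : i = j
  · subst hi
    exact ⟨by simpa [upper] using h, (hx i).2⟩
  · simpa [upper, hi] using hx i

/-- The rectangle is nondegenerate and contained in the unit cube. -/
def IsInCube (B : Box d) : Prop := ∀ i, 0 ≤ B.lo i ∧ B.lo i ≤ B.hi i ∧ B.hi i ≤ 1

theorem IsInCube.lower {B : Box d} (hB : B.IsInCube) (j : Fin d) : (B.lower j).IsInCube := by
  intro i
  by_cases hi : i = j
  · subst hi
    have := hB i
    simp only [Box.lower, mid, Function.update_self]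
    refine ⟨this.1, ?_, ?_⟩ <;> linarith
  · simpa [Box.lower, hi] using hB i

theorem IsInCube.upper {B : Box d} (hB : B.IsInCube) (j : Fin d) : (B.upper j).IsInCube := by
  intro i
  by_cases hi : i = j
  · subst hi
    have := hB i
    simp only [Box.upper, mid, Function.update_self]
    refine ⟨?_, ?_, ?_⟩ <;> linarith
  · simpa [Box.upper, hi] using hB i

theorem toSet_subset_Icc (B : Box d) {y : EuclideanSpace ℝ (Fin d)} (hy : y ∈ B.toSet)
    (i : Fin d) : y i ∈ Set.Icc (B.lo i) (B.hi i) := by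
  obtain ⟨h1, h2 | ⟨h2, h3⟩⟩ := hy i
  · exact ⟨h1, h2.le⟩
  · exact ⟨h1, by rw [h2, h3]⟩

theorem measurableSet_toSet (B : Box d) : MeasurableSet B.toSet := by
  have : B.toSet = ⋂ j, {y : EuclideanSpace ℝ (Fin d) |
      B.lo j ≤ y j ∧ (y j < B.hi j ∨ (y j = 1 ∧ B.hi j = 1))} := by
    ext y
    simp [toSet]
  rw [this]
  refine MeasurableSet.iInter fun j => ?_
  have hj : Measurable fun y : EuclideanSpace ℝ (Fin d) => y j := by fun_prop
  refine (measurableSet_le measurable_const hj).inter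
    ((measurableSet_lt hj measurable_const).union
      ((hj (measurableSet_singleton 1)).inter (.const _)))

/-- The half-open rectangle lies between the open and the closed one, which have equal volume, so
the convention on faces plays no role. -/
theorem volume_toSet {B : Box d} :
    volume B.toSet = ∏ i, ENNReal.ofReal (B.hi i - B.lo i) := by
  have hpre : ∀ s : Set (Fin d → ℝ), MeasurableSet s →
      volume {y : EuclideanSpace ℝ (Fin d) | (fun i => y i) ∈ s} = volume s := by
    intro s hs
    exact (EuclideanSpace.volume_preserving_symm_measurableEquiv_toLp (Fin d)).measure_preimage
      hs.nullMeasurableSet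
  refine le_antisymm ?_ ?_
  · rw [← Real.volume_Icc_pi, ← hpre _ measurableSet_Icc]
    refine measure_mono fun y hy => ?_
    exact ⟨fun i => (B.toSet_subset_Icc hy i).1, fun i => (B.toSet_subset_Icc hy i).2⟩
  · rw [← Real.volume_pi_Ioo, ← hpre _ (MeasurableSet.univ_pi fun _ => measurableSet_Ioo)]
    refine measure_mono fun y hy i => ?_
    have := hy i (Set.mem_univ i)
    exact ⟨this.1.le, Or.inl this.2⟩

theorem toSet_root (d : ℕ) : (Box.root d).toSet = unitCube (Fin d) := by
  ext x
  simp only [toSet, root, unitCube, Set.mem_ofPred_eq, Set.mem_Icc, and_true]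
  exact forall_congr' fun j => and_congr_right fun _ => le_iff_lt_or_eq.symm

theorem isInCube_root (d : ℕ) : (Box.root d).IsInCube := fun _ => by simp [root]

theorem IsInCube.toSet_subset {B : Box d} (hB : B.IsInCube) : B.toSet ⊆ unitCube (Fin d) :=
  fun _ hy i => ⟨(hB i).1.trans (B.toSet_subset_Icc hy i).1,
    (B.toSet_subset_Icc hy i).2.trans (hB i).2.2⟩

end Box

/-- Each cut halves exactly one factor of the product. The volume of a terminal cell thus depends on
the depth alone, and the probability of a hit is the same for all trees and query points. -/
theorem SplitTree.prod_side_boxIn {m : ℕ} (θ : SplitTree d m) (x : EuclideanSpace ℝ (Fin d))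
    (B : Box d) : ∏ i, ((θ.boxIn B x).hi i - (θ.boxIn B x).lo i) =
      (1 / 2) ^ m * ∏ i, (B.hi i - B.lo i) := by
  induction θ generalizing B with
  | leaf => simp [boxIn]
  | node j l r ihl ihr =>
    simp only [boxIn]
    split_ifs
    · simp_rw [ihl, Box.lower_side, Finset.prod_mul_distrib, Box.prod_half]
      ring
    · simp_rw [ihr, Box.upper_side, Finset.prod_mul_distrib, Box.prod_half]
      ring

theorem volume_unitCube (d : ℕ) : volume (unitCube (Fin d)) = 1 := by
  simp [← Box.toSet_root, Box.volume_toSet, Box.root]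

theorem measurableSet_unitCube (d : ℕ) : MeasurableSet (unitCube (Fin d)) := by
  rw [← Box.toSet_root]
  exact Box.measurableSet_toSet _

/-- The terminal rectangle that contains `x`, starting from the root. -/
noncomputable def SplitTree.box {m : ℕ} (θ : SplitTree d m) (x : EuclideanSpace ℝ (Fin d)) : Box d :=
  θ.boxIn (Box.root d) x

theorem SplitTree.cell_eq_toSet {m : ℕ} (θ : SplitTree d m) (x : EuclideanSpace ℝ (Fin d)) :
    θ.cell x = (θ.box x).toSet :=
  θ.cellIn_eq_toSet _ _

theorem SplitTree.isInCube_box {m : ℕ} (θ : SplitTree d m) (x : EuclideanSpace ℝ (Fin d)) :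
    (θ.box x).IsInCube :=
  θ.boxIn_induction x _ (fun _ j h _ => h.lower j) (fun _ j h _ => h.upper j) _
    (Box.isInCube_root d)

theorem SplitTree.mem_cell {m : ℕ} (θ : SplitTree d m) {x : EuclideanSpace ℝ (Fin d)}
    (hx : x ∈ unitCube (Fin d)) : x ∈ θ.cell x := by
  rw [cell_eq_toSet]
  exact θ.boxIn_induction x (fun B => x ∈ B.toSet) (fun _ _ h => Box.mem_lower h)
    (fun _ _ h => Box.mem_upper h) _ (by rwa [Box.toSet_root])

theorem SplitTree.measurableSet_cell {m : ℕ} (θ : SplitTree d m)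
    (x : EuclideanSpace ℝ (Fin d)) : MeasurableSet (θ.cell x) := by
  rw [cell_eq_toSet]
  exact Box.measurableSet_toSet _

theorem SplitTree.cell_subset {m : ℕ} (θ : SplitTree d m) (x : EuclideanSpace ℝ (Fin d)) :
    θ.cell x ⊆ unitCube (Fin d) := by
  rw [cell_eq_toSet]
  exact (θ.isInCube_box x).toSet_subset

theorem SplitTree.volume_cell {m : ℕ} (θ : SplitTree d m) (x : EuclideanSpace ℝ (Fin d)) :
    volume (θ.cell x) = ENNReal.ofReal ((1 / 2) ^ m) := by
  rw [cell_eq_toSet, Box.volume_toSet, ← ENNReal.ofReal_prod_of_nonneg, box, prod_side_boxIn]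
  · simp [Box.root]
  · exact fun i _ => sub_nonneg.2 (θ.isInCube_box x i).2.1

/-- Measurability jointly in the query point and the data point is what allows integration over the
query point later. -/
theorem SplitTree.measurableSet_cellIn_prod {m : ℕ} (θ : SplitTree d m) (B : Box d) :
    MeasurableSet {q : EuclideanSpace ℝ (Fin d) × EuclideanSpace ℝ (Fin d) |
      q.2 ∈ θ.cellIn B q.1} := by
  induction θ generalizing B with
  | leaf => exact measurable_snd B.measurableSet_toSet
  | node j l r ihl ihr =>
    have hlt : MeasurableSet {q : EuclideanSpace ℝ (Fin d) × EuclideanSpace ℝ (Fin d) |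
        q.1 j < B.mid j} :=
      measurableSet_lt (by fun_prop) measurable_const
    convert (hlt.inter (ihl (B.lower j))).union (hlt.compl.inter (ihr (B.upper j))) using 1
    ext q
    simp only [cellIn, Set.mem_ofPred_eq, Set.mem_union, Set.mem_inter_iff, Set.mem_compl_iff]
    split_ifs with h <;> simp [h]

theorem SplitTree.abs_sub_le_side {m : ℕ} (θ : SplitTree d m) {x y z : EuclideanSpace ℝ (Fin d)}
    (hy : y ∈ θ.cell x) (hz : z ∈ θ.cell x) (j : Fin d) :
    |y j - z j| ≤ (θ.box x).hi j - (θ.box x).lo j := by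
  rw [cell_eq_toSet] at hy hz
  have h1 := Box.toSet_subset_Icc _ hy j
  have h2 := Box.toSet_subset_Icc _ hz j
  rw [abs_le]
  constructor <;> linarith [h1.1, h1.2, h2.1, h2.2]

end Geometry

/-! ### The law of the tree -/

section TreeLaw

variable {d : ℕ}

instance SplitTree.instFinite (m : ℕ) : Finite (SplitTree d m) := by
  induction m with
  | zero => exact Finite.of_injective (fun _ => ()) fun a b _ => by cases a; cases b; rfl
  | succ m ih =>
    refine Finite.of_surjective
      (fun q : Fin d × SplitTree d m × SplitTree d m => SplitTree.node q.1 q.2.1 q.2.2) ?_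
    intro θ
    cases θ with
    | node j l r => exact ⟨(j, l, r), rfl⟩

noncomputable instance SplitTree.instFintype (m : ℕ) : Fintype (SplitTree d m) :=
  Fintype.ofFinite _

theorem SplitTree.sum_succ {m : ℕ} (f : SplitTree d (m + 1) → ℝ) :
    ∑ θ, f θ = ∑ j, ∑ l, ∑ r, f (.node j l r) := by
  simp_rw [← Fintype.sum_prod_type' (f := fun l r => f (.node _ l r))]
  rw [← Fintype.sum_prod_type' (f := fun j (q : SplitTree d m × SplitTree d m) =>
    f (.node j q.1 q.2))]
  refine (Fintype.sum_bijective
    (fun q : Fin d × SplitTree d m × SplitTree d m => SplitTree.node q.1 q.2.1 q.2.2)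
    ⟨?_, ?_⟩ _ _ fun _ => rfl).symm
  · rintro ⟨j, l, r⟩ ⟨j', l', r'⟩ h
    simpa using h
  · intro θ
    cases θ with
    | node j l r => exact ⟨(j, l, r), rfl⟩

theorem treeLaw_node (p : PMF (Fin d)) {m : ℕ} (j : Fin d) (l r : SplitTree d m) :
    treeLaw p (m + 1) (.node j l r) = p j * (treeLaw p m l * treeLaw p m r) := by
  classical
  simp only [treeLaw, PMF.bind_apply, PMF.pure_apply, SplitTree.node.injEq, tsum_fintype]
  rw [Finset.sum_eq_single j, Finset.sum_eq_single l, Finset.sum_eq_single r] <;>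
    simp +contextual [eq_comm]

/-- The probability that `Θ` equals a given tree. -/
noncomputable def treeWeight (p : PMF (Fin d)) {m : ℕ} (θ : SplitTree d m) : ℝ :=
  (treeLaw p m θ).toReal

theorem treeWeight_nonneg (p : PMF (Fin d)) {m : ℕ} (θ : SplitTree d m) : 0 ≤ treeWeight p θ :=
  ENNReal.toReal_nonneg

theorem sum_toReal_pmf {α : Type*} [Fintype α] (q : PMF α) : ∑ a, (q a).toReal = 1 := by
  rw [← ENNReal.toReal_sum fun a _ => q.apply_ne_top a, ← tsum_fintype (L := .unconditional _),
    q.tsum_coe, ENNReal.toReal_one]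

theorem sum_treeWeight (p : PMF (Fin d)) (m : ℕ) : ∑ θ : SplitTree d m, treeWeight p θ = 1 :=
  sum_toReal_pmf _

theorem treeWeight_node (p : PMF (Fin d)) {m : ℕ} (j : Fin d) (l r : SplitTree d m) :
    treeWeight p (.node j l r) = (p j).toReal * (treeWeight p l * treeWeight p r) := by
  simp [treeWeight, treeLaw_node]

/-- The mean square of the `i`-th side of a random terminal rectangle. -/
theorem sum_treeWeight_side_sq (p : PMF (Fin d)) (m : ℕ) (x : EuclideanSpace ℝ (Fin d))
    (i : Fin d) (B : Box d) :
    ∑ θ : SplitTree d m, treeWeight p θ * ((θ.boxIn B x).hi i - (θ.boxIn B x).lo i) ^ 2 =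
      (1 - 3 / 4 * (p i).toReal) ^ m * (B.hi i - B.lo i) ^ 2 := by
  induction m generalizing B with
  | zero =>
    have h := sum_treeWeight p 0
    have h1 : ∀ θ : SplitTree d 0, θ.boxIn B x = B := fun θ => by cases θ; rfl
    simp_rw [h1, ← Finset.sum_mul, h, pow_zero]
  | succ m ih =>
    have key : ∀ j : Fin d, ∑ l : SplitTree d m, ∑ r : SplitTree d m,
        treeWeight p (.node j l r) *
          (((SplitTree.node j l r).boxIn B x).hi i - ((SplitTree.node j l r).boxIn B x).lo i) ^ 2 =
        (1 - 3 / 4 * (p i).toReal) ^ m * (B.hi i - B.lo i) ^ 2 *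
          ((p j).toReal * (1 - 3 / 4 * if i = j then 1 else 0)) := by
      intro j
      -- A halved side loses three quarters of its square; this is the origin of 0.75 in the
      -- exponent.
      have hh : ((if i = j then 1 / 2 else 1 : ℝ)) ^ 2 = 1 - 3 / 4 * if i = j then 1 else 0 := by
        split_ifs <;> norm_num
      simp only [treeWeight_node, SplitTree.boxIn]
      -- Only the subtree on the side of `x` affects the terminal rectangle; the weights of the
      -- other subtree sum to one.
      by_cases h : x j < B.mid j
      · simp only [if_pos h]
        calc _ = ∑ l : SplitTree d m, ∑ r : SplitTree d m, treeWeight p r * ((p j).toReal *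
              (treeWeight p l * ((l.boxIn (B.lower j) x).hi i -
                (l.boxIn (B.lower j) x).lo i) ^ 2)) :=
              Finset.sum_congr rfl fun l _ => Finset.sum_congr rfl fun r _ => by ring
          _ = _ := by
            simp_rw [← Finset.sum_mul, sum_treeWeight, one_mul, ← Finset.mul_sum, ih,
              Box.lower_side, mul_pow, hh]
            ring
      · simp only [if_neg h]
        rw [Finset.sum_comm]
        calc _ = ∑ r : SplitTree d m, ∑ l : SplitTree d m, treeWeight p l * ((p j).toReal *
              (treeWeight p r * ((r.boxIn (B.upper j) x).hi i -
                (r.boxIn (B.upper j) x).lo i) ^ 2)) :=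
              Finset.sum_congr rfl fun l _ => Finset.sum_congr rfl fun r _ => by ring
          _ = _ := by
            simp_rw [← Finset.sum_mul, sum_treeWeight, one_mul, ← Finset.mul_sum, ih,
              Box.upper_side, mul_pow, hh]
            ring
    rw [SplitTree.sum_succ, Finset.sum_congr rfl fun j _ => key j, ← Finset.mul_sum]
    have : ∑ j, (p j).toReal * (1 - 3 / 4 * if i = j then 1 else 0 : ℝ) =
        1 - 3 / 4 * (p i).toReal := by
      simp_rw [mul_sub, mul_one, Finset.sum_sub_distrib, sum_toReal_pmf]
      simp [mul_comm]
    rw [this]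
    ring

theorem forestEstimate_eq_sum {n : ℕ} (p : PMF (Fin d)) (k : ℝ)
    (xs : Fin n → EuclideanSpace ℝ (Fin d)) (ys : Fin n → ℝ) (x : EuclideanSpace ℝ (Fin d)) :
    forestEstimate p k xs ys x =
      ∑ θ : SplitTree d (depth k), treeWeight p θ * treeEstimate θ xs ys x := by
  rw [forestEstimate, PMF.integral_eq_sum]
  rfl

/-- The convention for an empty cell agrees with division by zero being zero. -/
theorem treeEstimate_eq_div {m n : ℕ} (θ : SplitTree d m) (xs : Fin n → EuclideanSpace ℝ (Fin d))
    (ys : Fin n → ℝ) (x : EuclideanSpace ℝ (Fin d)) :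
    treeEstimate θ xs ys x =
      (∑ i, (θ.cell x).indicator (fun _ => ys i) (xs i)) / cellCount θ xs x := by
  rw [treeEstimate]
  split_ifs with h
  · rfl
  · rw [not_not.1 h, div_zero]

theorem measurable_forestEstimate {n : ℕ} (p : PMF (Fin d)) (k : ℝ) :
    Measurable fun q : EuclideanSpace ℝ (Fin d) × (ℕ → EuclideanSpace ℝ (Fin d) × ℝ) =>
      forestEstimate p k (fun i : Fin n => (q.2 i).1) (fun i : Fin n => (q.2 i).2) q.1 := by
  simp_rw [forestEstimate_eq_sum, treeEstimate_eq_div, cellCount]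
  have key : ∀ (θ : SplitTree d (depth k)) (i : ℕ)
      (f : EuclideanSpace ℝ (Fin d) × (ℕ → EuclideanSpace ℝ (Fin d) × ℝ) → ℝ), Measurable f →
      Measurable fun q : EuclideanSpace ℝ (Fin d) × (ℕ → EuclideanSpace ℝ (Fin d) × ℝ) =>
        (θ.cell q.1).indicator (fun _ => f q) (q.2 i).1 := by
    intro θ i f hf
    have hm : Measurable fun q : EuclideanSpace ℝ (Fin d) × (ℕ → EuclideanSpace ℝ (Fin d) × ℝ) =>
        (q.1, (q.2 i).1) := by fun_prop
    exact hf.indicator (hm (θ.measurableSet_cellIn_prod (Box.root d)))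
  refine Finset.measurable_sum _ fun θ _ => Measurable.const_mul (Measurable.div ?_ ?_) _
  · exact Finset.measurable_sum _ fun i _ => key θ i (fun q => (q.2 i).2) (by fun_prop)
  · exact Finset.measurable_sum _ fun i _ => key θ i (fun _ => 1) measurable_const

end TreeLaw

end RandomForest

namespace RandomForest

/-! ### Binomial means -/

/-- The mean of `f` under the binomial law with parameters `n` and `l`. -/
noncomputable def binomialMean (l : ℝ) : ℕ → (ℕ → ℝ) → ℝ
  | 0, f => f 0
  | n + 1, f => (1 - l) * binomialMean l n f + l * binomialMean l n fun k => f (k + 1)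

section BinomialMean

variable {l : ℝ}

theorem binomialMean_mono (h0 : 0 ≤ l) (h1 : l ≤ 1) (n : ℕ) {f g : ℕ → ℝ} (h : ∀ k, f k ≤ g k) :
    binomialMean l n f ≤ binomialMean l n g := by
  induction n generalizing f g with
  | zero => exact h 0
  | succ n ih =>
    exact add_le_add (mul_le_mul_of_nonneg_left (ih h) (by linarith))
      (mul_le_mul_of_nonneg_left (ih fun k => h _) h0)

theorem binomialMean_const (c : ℝ) (n : ℕ) : binomialMean l n (fun _ => c) = c := by
  induction n with
  | zero => rfl
  | succ n ih =>
    simp only [binomialMean, ih]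
    ring

theorem binomialMean_add (n : ℕ) (f g : ℕ → ℝ) :
    binomialMean l n (fun k => f k + g k) = binomialMean l n f + binomialMean l n g := by
  induction n generalizing f g with
  | zero => rfl
  | succ n ih =>
    simp only [binomialMean, ih]
    ring

theorem binomialMean_const_mul (c : ℝ) (n : ℕ) (f : ℕ → ℝ) :
    binomialMean l n (fun k => c * f k) = c * binomialMean l n f := by
  induction n generalizing f with
  | zero => rfl
  | succ n ih =>
    simp only [binomialMean, ih]
    ring

/-- The size-bias identity of the binomial law. -/
theorem binomialMean_size_bias (n : ℕ) (f : ℕ → ℝ) :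
    binomialMean l (n + 1) (fun k => k * f k) =
      (n + 1) * l * binomialMean l n fun k => f (k + 1) := by
  induction n generalizing f with
  | zero => simp [binomialMean]
  | succ n ih =>
    rw [binomialMean, ih]
    have : (fun k : ℕ => ((k + 1 : ℕ) : ℝ) * f (k + 1)) =
        fun k : ℕ => k * f (k + 1) + f (k + 1) := by
      funext k
      push_cast
      ring
    rw [this, binomialMean_add, ih fun k => f (k + 1)]
    simp only [binomialMean]
    push_cast
    ring

theorem binomialMean_indicator_zero (n : ℕ) :
    binomialMean l n (fun k => if k = 0 then 1 else 0) = (1 - l) ^ n := by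
  induction n with
  | zero => simp [binomialMean]
  | succ n ih =>
    simp only [binomialMean, ih, Nat.add_eq_zero_iff, one_ne_zero, and_false, if_false,
      binomialMean_const]
    ring

/-- Size bias with `f k = 1/k`: here `k * f k` is at most 1, being 0 at `k = 0`. -/
theorem binomialMean_inv_succ_le (h0 : 0 < l) (h1 : l ≤ 1) (n : ℕ) :
    binomialMean l n (fun k => ((k : ℝ) + 1)⁻¹) ≤ ((n + 1) * l)⁻¹ := by
  have h := binomialMean_size_bias (l := l) n fun k => (k : ℝ)⁻¹
  push_cast at h
  rw [← one_div, le_div_iff₀' (by positivity), ← h]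
  refine (binomialMean_mono h0.le h1 _ fun k => ?_).trans_eq (binomialMean_const 1 _)
  exact mul_inv_le_one

/-- The square is compared with `1/((k+1)(k+2))`, at the cost of the factor 2, because the latter
can be size-biased twice. -/
theorem binomialMean_inv_succ_sq_le (h0 : 0 < l) (h1 : l ≤ 1) (n : ℕ) :
    binomialMean l n (fun k => (((k : ℝ) + 1) ^ 2)⁻¹) ≤ 2 * (((n + 1) * (n + 2)) * l ^ 2)⁻¹ := by
  have h := binomialMean_size_bias (l := l) n fun k => (k : ℝ)⁻¹ * ((k : ℝ) + 1)⁻¹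
  have h2 : binomialMean l (n + 1) (fun k => (k : ℝ) * ((k : ℝ)⁻¹ * ((k : ℝ) + 1)⁻¹)) ≤
      (((n + 1 : ℕ) + 1) * l)⁻¹ := by
    refine (binomialMean_mono h0.le h1 _ fun k => ?_).trans (binomialMean_inv_succ_le h0 h1 _)
    rw [← mul_assoc]
    exact mul_le_of_le_one_left (by positivity) mul_inv_le_one
  rw [h] at h2
  have h3 : binomialMean l n (fun k => (((k : ℝ) + 1) ^ 2)⁻¹) ≤
      2 * binomialMean l n fun k => ((k + 1 : ℕ) : ℝ)⁻¹ * (((k + 1 : ℕ) : ℝ) + 1)⁻¹ := by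
    rw [← binomialMean_const_mul]
    refine binomialMean_mono h0.le h1 _ fun k => ?_
    push_cast
    rw [← mul_inv, ← one_div, ← div_eq_mul_inv, div_le_div_iff₀ (by positivity) (by positivity)]
    nlinarith [(k.cast_nonneg : (0 : ℝ) ≤ k)]
  refine h3.trans (mul_le_mul_of_nonneg_left ?_ zero_le_two)
  have hn : 0 < ((n : ℝ) + 1) * l := by positivity
  rw [mul_comm, ← le_div_iff₀ hn] at h2
  refine h2.trans_eq ?_
  push_cast
  field_simp
  ring

end BinomialMean

/-! ### Averages over the data that fall in a given cell -/

section Averages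

variable {Ω E : Type*} [MeasurableSpace Ω] [MeasurableSpace E] {P : Measure Ω}
  [IsProbabilityMeasure P] {Z : ℕ → Ω → E} {h : E → ℕ} {φ : E → ℝ} {l : ℝ}

/-- Splitting off one observation, whose hit variable is 0 or 1 and independent of the remaining
count, reproduces the recursion that defines `binomialMean`. The bound on `f` serves integrability.
-/
theorem integral_count_eq_binomialMean (hZ : ∀ i, Measurable (Z i)) (hind : iIndepFun Z P)
    (hh : Measurable h) (hh1 : ∀ z, h z ≤ 1) (hl : ∀ i, ∫ ω, (h (Z i ω) : ℝ) ∂P = l)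
    (I : Finset ℕ) (f : ℕ → ℝ) (hf : ∀ k, |f k| ≤ 1) :
    ∫ ω, f (∑ i ∈ I, h (Z i ω)) ∂P = binomialMean l I.card f := by
  classical
  induction I using Finset.induction_on generalizing f with
  | empty => simp [binomialMean]
  | insert a I ha ih =>
    have hmeas : ∀ i, Measurable fun ω => h (Z i ω) := fun i => hh.comp (hZ i)
    have hN : Measurable fun ω => ∑ i ∈ I, h (Z i ω) := Finset.measurable_sum _ fun i _ => hmeas i
    have hi : IndepFun (fun ω => h (Z a ω)) (fun ω => ∑ i ∈ I, h (Z i ω)) P := by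
      have := (hind.comp (fun _ => h) fun _ => hh).indepFun_finsetSum_of_notMem hmeas ha
      rw [show (∑ j ∈ I, h ∘ Z j) = fun ω => ∑ i ∈ I, h (Z i ω) by funext ω; simp] at this
      exact this.symm
    have hmul : ∀ (u v : ℕ → ℝ), ∫ ω, u (h (Z a ω)) * v (∑ i ∈ I, h (Z i ω)) ∂P =
        (∫ ω, u (h (Z a ω)) ∂P) * ∫ ω, v (∑ i ∈ I, h (Z i ω)) ∂P := fun u v =>
      (hi.comp (measurable_of_countable u) (measurable_of_countable v)).integral_fun_mul_eq_mul_integral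
        ((measurable_of_countable u).comp (hmeas a)).aestronglyMeasurable
        ((measurable_of_countable v).comp hN).aestronglyMeasurable
    have hH : Integrable (fun ω => (h (Z a ω) : ℝ)) P := by
      refine Integrable.of_bound
        ((measurable_of_countable (fun k : ℕ => (k : ℝ))).comp (hmeas a)).aestronglyMeasurable 1
        (.of_forall fun ω => ?_)
      simpa using hh1 (Z a ω)
    have hint : ∀ (u v : ℕ → ℝ), (∀ k, k ≤ 1 → |u k| ≤ 1) → (∀ k, |v k| ≤ 1) →
        Integrable (fun ω => u (h (Z a ω)) * v (∑ i ∈ I, h (Z i ω))) P := by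
      intro u v hu hv
      refine Integrable.of_bound (((measurable_of_countable u).comp (hmeas a)).mul
        ((measurable_of_countable v).comp hN)).aestronglyMeasurable 1 (.of_forall fun ω => ?_)
      rw [Real.norm_eq_abs, abs_mul]
      exact mul_le_one₀ (hu _ (hh1 _)) (abs_nonneg _) (hv _)
    have hsplit : ∀ ω, f (∑ i ∈ insert a I, h (Z i ω)) =
        (1 - (h (Z a ω) : ℝ)) * f (∑ i ∈ I, h (Z i ω)) +
          (h (Z a ω) : ℝ) * f (∑ i ∈ I, h (Z i ω) + 1) := by
      intro ω
      rw [Finset.sum_insert ha]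
      rcases Nat.le_one_iff_eq_zero_or_eq_one.1 (hh1 (Z a ω)) with h0 | h0
      · simp [h0]
      · simp [h0, add_comm]
    simp_rw [hsplit]
    rw [integral_add (hint (fun k => 1 - k) f ?_ hf)
      (hint (fun k => k) (fun k => f (k + 1)) ?_ fun k => hf _),
      hmul (fun k => 1 - k) f, hmul (fun k => k) fun k => f (k + 1), integral_sub (by simp) hH,
      hl, ih f hf, ih (fun k => f (k + 1)) fun k => hf _, Finset.card_insert_of_notMem ha]
    · simp [binomialMean]
    · intro k hk
      rcases Nat.le_one_iff_eq_zero_or_eq_one.1 hk with rfl | rfl <;> simp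
    · intro k hk
      simpa using hk

/-- The second moment of the average of centred variables over a random subsample. -/
theorem integral_sq_sum_div_count_le (hZ : ∀ i, Measurable (Z i)) (hind : iIndepFun Z P)
    (hh : Measurable h) (hh1 : ∀ z, h z ≤ 1) (hl : ∀ i, ∫ ω, (h (Z i ω) : ℝ) ∂P = l)
    (hl0 : 0 < l) (hl1 : l ≤ 1) (hφ : Measurable φ) (hφh : ∀ z, h z = 0 → φ z = 0)
    (hφ2 : ∀ i, MemLp (fun ω => φ (Z i ω)) 2 P) (hφ0 : ∀ i, ∫ ω, φ (Z i ω) ∂P = 0)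
    {v : ℝ} (hv : 0 ≤ v) (hφv : ∀ i, ∫ ω, φ (Z i ω) ^ 2 ∂P ≤ v * l) (I : Finset ℕ) :
    Integrable (fun ω => ((∑ i ∈ I, φ (Z i ω)) / ((∑ i ∈ I, h (Z i ω) : ℕ) : ℝ)) ^ 2) P ∧
    ∫ ω, ((∑ i ∈ I, φ (Z i ω)) / ((∑ i ∈ I, h (Z i ω) : ℕ) : ℝ)) ^ 2 ∂P ≤
      2 * v / ((I.card + 1) * l) := by
  classical
  have hmeas : ∀ i, Measurable fun ω => h (Z i ω) := fun i => hh.comp (hZ i)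
  have hφm : ∀ i, Measurable fun ω => φ (Z i ω) := fun i => hφ.comp (hZ i)
  set g : ℕ → ℝ := fun k => (((k : ℝ) + 1) ^ 2)⁻¹ with hg
  have hg1 : ∀ k, |g k| ≤ 1 := by
    intro k
    rw [abs_of_nonneg (by positivity)]
    exact inv_le_one_of_one_le₀ (one_le_pow₀ (by simp))
  -- Where `φ (Z i)` is nonzero, observation `i` is a hit, so the count is one plus the count over
  -- the others. The random denominator thereby becomes independent of `Z i`.
  have hsplit : ∀ i ∈ I, ∀ j ω, φ (Z i ω) * φ (Z j ω) * (((∑ i ∈ I, h (Z i ω) : ℕ) : ℝ) ^ 2)⁻¹ =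
      φ (Z i ω) * (φ (Z j ω) * g (∑ t ∈ I.erase i, h (Z t ω))) := by
    intro i hi j ω
    rcases Nat.le_one_iff_eq_zero_or_eq_one.1 (hh1 (Z i ω)) with h0 | h0
    · simp [hφh _ h0]
    · rw [← Finset.sum_erase_add _ _ hi, h0, hg]
      push_cast
      ring
  have hexp : ∀ ω, ((∑ i ∈ I, φ (Z i ω)) / ((∑ i ∈ I, h (Z i ω) : ℕ) : ℝ)) ^ 2 =
      ∑ i ∈ I, ∑ j ∈ I, φ (Z i ω) * (φ (Z j ω) * g (∑ t ∈ I.erase i, h (Z t ω))) := by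
    intro ω
    rw [div_pow, sq (∑ i ∈ I, φ (Z i ω)), Finset.sum_mul_sum, div_eq_mul_inv, Finset.sum_mul]
    refine Finset.sum_congr rfl fun i hi => ?_
    rw [Finset.sum_mul]
    exact Finset.sum_congr rfl fun j _ => hsplit i hi j ω
  have hgm : ∀ i, Measurable fun ω => g (∑ t ∈ I.erase i, h (Z t ω)) := fun i =>
    (measurable_of_countable g).comp (Finset.measurable_sum _ fun t _ => hmeas t)
  have hint : ∀ i j, Integrable
      (fun ω => φ (Z i ω) * (φ (Z j ω) * g (∑ t ∈ I.erase i, h (Z t ω)))) P := by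
    intro i j
    refine ((hφ2 i).integrable_mul (hφ2 j)).mono
      ((hφm i).mul ((hφm j).mul (hgm i))).aestronglyMeasurable (.of_forall fun ω => ?_)
    simp only [norm_mul, Pi.mul_apply, ← mul_assoc]
    exact mul_le_of_le_one_right (by positivity) (hg1 _)
  have hindep : ∀ i ∈ I, ∀ (u : E → ℝ) (w : (I.erase i → E) → ℝ), Measurable u → Measurable w →
      ∫ ω, u (Z i ω) * w (fun t => Z t ω) ∂P =
        (∫ ω, u (Z i ω) ∂P) * ∫ ω, w (fun t => Z t ω) ∂P := by
    intro i hi u w hu hw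
    have hd : Disjoint ({i} : Finset ℕ) (I.erase i) := by simp
    have h1 := (hind.indepFun_finset {i} (I.erase i) hd hZ).comp
      (φ := fun q : (({i} : Finset ℕ) → E) => u (q ⟨i, Finset.mem_singleton_self i⟩)) (ψ := w)
      (by fun_prop) hw
    exact h1.integral_fun_mul_eq_mul_integral (hu.comp (hZ i)).aestronglyMeasurable
      (hw.comp (measurable_pi_lambda _ fun t => hZ t)).aestronglyMeasurable
  have hwm : ∀ i, Measurable fun q : I.erase i → E => g (∑ t, h (q t)) := fun i =>
    (measurable_of_countable g).comp (Finset.measurable_sum _ fun t _ => hh.comp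
      (measurable_pi_apply t))
  have hsum : ∀ i ω, ∑ t : I.erase i, h (Z t ω) = ∑ t ∈ I.erase i, h (Z t ω) := fun i ω =>
    Finset.sum_coe_sort (I.erase i) fun t => h (Z t ω)
  -- Both `φ (Z j)` and the reduced count depend on observations other than `i` only, so the centred
  -- factor `φ (Z i)` separates and the cross term vanishes.
  have hoff : ∀ i ∈ I, ∀ j ∈ I, j ≠ i →
      ∫ ω, φ (Z i ω) * (φ (Z j ω) * g (∑ t ∈ I.erase i, h (Z t ω))) ∂P = 0 := by
    intro i hi j hj hij
    have h1 := hindep i hi φ (fun q => φ (q ⟨j, Finset.mem_erase.2 ⟨hij, hj⟩⟩) * g (∑ t, h (q t)))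
      hφ ((hφ.comp (measurable_pi_apply _)).mul (hwm i))
    simp only [hsum, hφ0, zero_mul] at h1
    exact h1
  have hdiag : ∀ i ∈ I,
      ∫ ω, φ (Z i ω) * (φ (Z i ω) * g (∑ t ∈ I.erase i, h (Z t ω))) ∂P ≤
        v * l * (2 * (((I.card : ℝ) * (I.card + 1)) * l ^ 2)⁻¹) := by
    intro i hi
    have h1 := hindep i hi (fun z => φ z ^ 2) (fun q => g (∑ t, h (q t))) (hφ.pow_const 2) (hwm i)
    simp only [hsum] at h1
    have hsq : ∀ ω, φ (Z i ω) * (φ (Z i ω) * g (∑ t ∈ I.erase i, h (Z t ω))) =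
        φ (Z i ω) ^ 2 * g (∑ t ∈ I.erase i, h (Z t ω)) := fun ω => by ring
    simp_rw [hsq]
    rw [h1, integral_count_eq_binomialMean hZ hind hh hh1 hl _ g hg1]
    have h2 := binomialMean_inv_succ_sq_le hl0 hl1 (I.erase i).card
    have h3 : ((I.erase i).card : ℝ) + 1 = I.card := by
      exact_mod_cast Finset.card_erase_add_one hi
    rw [show ((I.erase i).card : ℝ) + 2 = I.card + 1 by linarith, h3] at h2
    refine mul_le_mul (hφv i) h2 ?_ (by positivity)
    refine (binomialMean_const (l := l) 0 (I.erase i).card).symm.le.trans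
      (binomialMean_mono hl0.le hl1 _ fun k => by positivity)
  simp_rw [hexp]
  refine ⟨integrable_finsetSum _ fun i _ => integrable_finsetSum _ fun j _ => hint i j, ?_⟩
  rw [integral_finsetSum _ fun i _ => integrable_finsetSum _ fun j _ => hint i j]
  calc _ ≤ ∑ _i ∈ I, v * l * (2 * (((I.card : ℝ) * (I.card + 1)) * l ^ 2)⁻¹) := by
        refine Finset.sum_le_sum fun i hi => ?_
        rw [integral_finsetSum _ fun j _ => hint i j,
          Finset.sum_eq_single_of_mem i hi fun j hj hji => hoff i hi j hj hji]
        exact hdiag i hi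
    _ ≤ _ := by
        rw [Finset.sum_const, nsmul_eq_mul]
        rcases I.eq_empty_or_nonempty with rfl | hI
        · simp only [Finset.card_empty, Nat.cast_zero, zero_mul]
          positivity
        · have : (0 : ℝ) < I.card := by exact_mod_cast hI.card_pos
          refine le_of_eq ?_
          field_simp

end Averages

end RandomForest

namespace RandomForest

/-! ### Numerical estimates -/

section Numerical

/-- Rounding `log₂ k` up adds less than one level, hence at most a factor 2. -/
theorem two_pow_depth_le {k : ℝ} (hk : 2 ≤ k) : (2 : ℝ) ^ depth k ≤ 2 * k := by
  have h := (Nat.ceil_lt_add_one (Real.logb_nonneg one_lt_two (by linarith : 1 ≤ k))).le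
  rw [← Real.rpow_natCast, depth]
  refine (Real.rpow_le_rpow_of_exponent_le one_le_two h).trans_eq ?_
  rw [Real.rpow_add two_pos, Real.rpow_logb two_pos (by norm_num) (by linarith), Real.rpow_one,
    mul_comm]

theorem one_sub_half_pow_le {k : ℝ} (hk : 2 ≤ k) {n : ℕ} (hn : 1 ≤ n) :
    (1 - (1 / 2 : ℝ) ^ depth k) ^ n ≤ 2 * Real.exp (-1) * (k / n) := by
  have hn0 : (0 : ℝ) < n := by exact_mod_cast hn
  set x : ℝ := n / (2 * k) with hx
  have hx0 : 0 < x := by positivity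
  have h1 : (1 - (1 / 2 : ℝ) ^ depth k) ^ n ≤ Real.exp (-x) := by
    have h2 : 1 - (1 / 2 : ℝ) ^ depth k ≤ Real.exp (-(1 / (2 * k))) := by
      have h3 := Real.add_one_le_exp (-(1 / (2 * k)))
      have h4 : 1 / (2 * k) ≤ (1 / 2 : ℝ) ^ depth k := by
        rw [one_div_pow]
        exact one_div_le_one_div_of_le (by positivity) (two_pow_depth_le hk)
      linarith
    refine (pow_le_pow_left₀ (sub_nonneg.2 (pow_le_one₀ (by norm_num) (by norm_num))) h2 n).trans_eq
      ?_
    rw [← Real.exp_nat_mul, hx]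
    congr 1
    ring
  refine h1.trans ?_
  -- The function `x e^(-x)` is maximal at `x = 1`; equivalently `x ≤ e^(x-1)`.
  have h5 : x * Real.exp (-x) ≤ Real.exp (-1) := by
    have h6 := Real.add_one_le_exp (x - 1)
    calc x * Real.exp (-x) ≤ Real.exp (x - 1) * Real.exp (-x) :=
          mul_le_mul_of_nonneg_right (by linarith) (Real.exp_nonneg _)
      _ = Real.exp (-1) := by rw [← Real.exp_add]; congr 1; ring
  have h7 : 2 * Real.exp (-1) * (k / n) = Real.exp (-1) / x := by
    rw [hx]
    field_simp
  rw [h7, le_div_iff₀' hx0]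
  exact h5

/-- Combines `1 - t ≤ e^(-t)` with `depth k ≥ log k / log 2`; the rounding up helps here. -/
theorem pow_depth_le_rpow {k q e : ℝ} (hk : 2 ≤ k) (hq1 : q ≤ 1) (he : e ≤ 0.75 * q / Real.log 2)
    (hq0 : 0 ≤ q) : (1 - 3 / 4 * q) ^ depth k ≤ 1 / k ^ e := by
  have hk0 : 0 < k := by linarith
  have h1 : (1 - 3 / 4 * q) ^ depth k ≤ Real.exp (-(3 / 4 * q) * depth k) := by
    rw [mul_comm _ (depth k : ℝ), Real.exp_nat_mul]
    refine pow_le_pow_left₀ (by linarith) ?_ _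
    have := Real.add_one_le_exp (-(3 / 4 * q))
    linarith
  refine h1.trans ?_
  rw [one_div, ← Real.rpow_neg hk0.le, Real.rpow_def_of_pos hk0, Real.exp_le_exp]
  have h2 : Real.log k / Real.log 2 ≤ depth k := Nat.le_ceil (Real.logb 2 k)
  have h3 : 0 ≤ Real.log k := Real.log_nonneg (by linarith)
  have h4 := mul_le_mul_of_nonneg_left he h3
  have h5 := mul_le_mul_of_nonneg_left h2 (by linarith : 0 ≤ 3 / 4 * q)
  have h6 : Real.log k * (0.75 * q / Real.log 2) = 3 / 4 * q * (Real.log k / Real.log 2) := by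
    norm_num
    ring
  linarith

variable {d : ℕ}

/-- The bias exponents are all at least the one that corresponds to the smallest `ξ_j`. -/
theorem sum_pow_depth_le {S : Finset (Fin d)} (hS : 2 ≤ S.card) {k : ℝ} (hk : 2 ≤ k)
    {q ξ : Fin d → ℝ} (hq : ∀ j, q j ∈ Set.Ioo (0 : ℝ) 1)
    (hqξ : ∀ j ∈ S, q j = 1 / (S.card : ℝ) * (1 + ξ j)) :
    ∑ j ∈ S, (1 - 3 / 4 * q j) ^ depth k ≤
      S.card / k ^ (0.75 / ((S.card : ℝ) * Real.log 2) * (1 + gammaMin S ξ)) := by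
  have hS0 : (0 : ℝ) < S.card := by exact_mod_cast (by omega : 0 < S.card)
  have hlog : 0 < Real.log 2 := Real.log_pos one_lt_two
  refine (Finset.sum_le_card_nsmul S _ _ fun j hj => pow_depth_le_rpow
    (e := 0.75 / ((S.card : ℝ) * Real.log 2) * (1 + gammaMin S ξ)) hk (hq j).2.le ?_
    (hq j).1.le).trans_eq ?_
  · have h : gammaMin S ξ ≤ ξ j :=
      ciInf_le (Set.finite_range fun j : S => ξ j).bddBelow ⟨j, hj⟩
    calc _ ≤ 0.75 / ((S.card : ℝ) * Real.log 2) * (1 + ξ j) := by gcongr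
      _ = _ := by
        rw [hqξ j hj]
        field_simp
  · rw [nsmul_eq_mul, mul_one_div]

/-- The factors of the variance constant combine to a product over `1 / (p_j (1 - p_j))`. -/
theorem eight_le_variance_constant {S : Finset (Fin d)} (hS : 2 ≤ S.card) {q ξ : Fin d → ℝ}
    (hq : ∀ j, q j ∈ Set.Ioo (0 : ℝ) 1) (hqξ : ∀ j ∈ S, q j = 1 / (S.card : ℝ) * (1 + ξ j)) :
    8 ≤ constC S.card d * ((S.card : ℝ) ^ 2 / ((S.card : ℝ) - 1)) ^ ((S.card : ℝ) / (2 * d)) *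
      (1 + xiBar S ξ) := by
  have hS2 : (2 : ℝ) ≤ S.card := by exact_mod_cast hS
  have hSd : (S.card : ℝ) ≤ d := by exact_mod_cast (Finset.card_le_univ S).trans_eq (by simp)
  have hlog : 0.6931471803 < Real.log 2 := Real.log_two_gt_d9
  have hpi := Real.pi_gt_three
  have hpi' := Real.pi_lt_four
  set a : ℝ := (S.card : ℝ) ^ 2 / ((S.card : ℝ) - 1) with ha
  have ha0 : 0 < a := div_pos (by positivity) (by linarith)
  set e : ℝ := 1 / (2 * (d : ℝ)) with he
  have he0 : 0 ≤ e := by positivity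
  have hexp : (S.card : ℝ) / (2 * d) = e * S.card := by rw [he]; ring
  have hpow : ∀ {b : ℝ}, 0 ≤ b → b ^ ((S.card : ℝ) / (2 * d)) = ∏ _j ∈ S, b ^ e := by
    intro b hb
    rw [hexp, Real.rpow_mul hb, Real.rpow_natCast, Finset.prod_const]
  have cancel : ∀ {s t q w : ℝ}, s ≠ 0 → t ≠ 0 → q ≠ 0 → w ≠ 0 →
      s ^ 2 / t * ((s * q)⁻¹ * (s * w / t)⁻¹) = 1 / (q * w) := by
    intro s t q w _ _ _ _
    field_simp
  have hfac : ∀ j ∈ S, (4 : ℝ) ^ e ≤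
      a ^ e * ((1 + ξ j)⁻¹ * (1 - ξ j / ((S.card : ℝ) - 1))⁻¹) ^ e := by
    intro j hj
    have hq0 := (hq j).1
    have hq1 := (hq j).2
    have hξ : ξ j = S.card * q j - 1 := by rw [hqξ j hj]; field_simp; ring
    have hS1 : (S.card : ℝ) - 1 ≠ 0 := by linarith
    have e1 : 1 + ξ j = S.card * q j := by rw [hξ]; ring
    have e2 : 1 - ξ j / ((S.card : ℝ) - 1) = S.card * (1 - q j) / (S.card - 1) := by
      rw [eq_div_iff hS1, sub_mul, div_mul_cancel₀ _ hS1, hξ]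
      ring
    have hq1' : 0 < 1 - q j := by linarith
    -- All dependence on `S.card` cancels, and `4 q (1 - q) ≤ 1` then makes every factor at least `4
    -- ^ e`.
    have e3 : a * ((1 + ξ j)⁻¹ * (1 - ξ j / ((S.card : ℝ) - 1))⁻¹) = 1 / (q j * (1 - q j)) := by
      rw [e1, e2, ha]
      exact cancel (by linarith) hS1 hq0.ne' hq1'.ne'
    have hpos : 0 ≤ (1 + ξ j)⁻¹ * (1 - ξ j / ((S.card : ℝ) - 1))⁻¹ := by
      rw [e1, e2]
      exact mul_nonneg (inv_nonneg.2 (mul_nonneg (by linarith) hq0.le))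
        (inv_nonneg.2 (div_nonneg (mul_nonneg (by linarith) hq1'.le) (by linarith)))
    rw [← Real.mul_rpow ha0.le hpos, e3]
    refine Real.rpow_le_rpow (by norm_num) ?_ he0
    rw [le_div_iff₀ (mul_pos hq0 hq1')]
    nlinarith [sq_nonneg (2 * q j - 1)]
  have hprod : (4 : ℝ) ^ ((S.card : ℝ) / (2 * d)) ≤
      a ^ ((S.card : ℝ) / (2 * d)) * (1 + xiBar S ξ) := by
    rw [hpow (by norm_num), hpow ha0.le, xiBar, add_sub_cancel, ← Finset.prod_mul_distrib]
    exact Finset.prod_le_prod (fun _ _ => by positivity) hfac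
  -- The base `π log 2 / 4` exceeds `1/4` and the exponent is at most 1. With `288/π ≥ 72` the
  -- constant is at least 18, well above 8.
  have hb : (1 / 4 : ℝ) ≤ (Real.pi * Real.log 2 / 16 * 4) ^ ((S.card : ℝ) / (2 * d)) := by
    calc (1 / 4 : ℝ) = (1 / 4) ^ (1 : ℝ) := by simp
      _ ≤ (1 / 4) ^ ((S.card : ℝ) / (2 * d)) := by
        refine Real.rpow_le_rpow_of_exponent_ge (by norm_num) (by norm_num) ?_
        rw [div_le_one (by linarith)]
        linarith
      _ ≤ _ := by
        refine Real.rpow_le_rpow (by norm_num) ?_ (by positivity)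
        nlinarith
  rw [Real.mul_rpow (by positivity) (by norm_num)] at hb
  have hc : (72 : ℝ) ≤ 288 / Real.pi := by
    rw [le_div_iff₀ (by positivity)]
    linarith
  rw [constC, mul_assoc, mul_assoc]
  calc (8 : ℝ) ≤ 72 * (1 / 4) := by norm_num
    _ ≤ 288 / Real.pi * ((Real.pi * Real.log 2 / 16) ^ ((S.card : ℝ) / (2 * d)) *
        4 ^ ((S.card : ℝ) / (2 * d))) := by gcongr
    _ ≤ _ := by gcongr

/-- The bound on the error for a fixed query point is at most the bound of the theorem. -/
theorem fixed_query_bound_le {S : Finset (Fin d)} (hS : 2 ≤ S.card) {k σ : ℝ} (hk : 2 ≤ k)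
    {q ξ : Fin d → ℝ} (hq : ∀ j, q j ∈ Set.Ioo (0 : ℝ) 1)
    (hqξ : ∀ j ∈ S, q j = 1 / (S.card : ℝ) * (1 + ξ j)) (rstar : EuclideanSpace ℝ S → ℝ)
    (L : ℝ≥0) {n : ℕ} (hn : 1 ≤ n) :
    2 * (2 * σ ^ 2 / ((n + 1) * (1 / 2) ^ depth k)) +
      2 * (L : ℝ) ^ 2 * ∑ j ∈ S, (1 - 3 / 4 * q j) ^ depth k +
      supSq S rstar * (1 - (1 / 2) ^ depth k) ^ n ≤
    bigXi S rstar σ ξ * (k / n) + 2 * (S.card : ℝ) * (L : ℝ) ^ 2 /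
      k ^ (0.75 / ((S.card : ℝ) * Real.log 2) * (1 + gammaMin S ξ)) := by
  have hn0 : (0 : ℝ) < n := by exact_mod_cast hn
  have hsup : 0 ≤ supSq S rstar := Real.iSup_nonneg fun _ => sq_nonneg _
  have h1 : 2 * (2 * σ ^ 2 / ((n + 1) * (1 / 2) ^ depth k)) ≤ 8 * (σ ^ 2 * (k / n)) := by
    have h2 := two_pow_depth_le hk
    calc 2 * (2 * σ ^ 2 / ((n + 1) * (1 / 2) ^ depth k))
        = 4 * σ ^ 2 * (2 ^ depth k / (n + 1)) := by
          rw [one_div_pow]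
          field_simp
          ring
      _ ≤ 4 * σ ^ 2 * (2 * k / n) := by
          gcongr
          linarith
      _ = _ := by ring
  have h2 := mul_le_mul_of_nonneg_right (eight_le_variance_constant hS hq hqξ)
    (by positivity : 0 ≤ σ ^ 2 * (k / n))
  have h3 := mul_le_mul_of_nonneg_left (one_sub_half_pow_le hk hn) hsup
  have h4 := mul_le_mul_of_nonneg_left (sum_pow_depth_le hS hk hq hqξ)
    (by positivity : 0 ≤ 2 * (L : ℝ) ^ 2)
  have h5 : 2 * (S.card : ℝ) * (L : ℝ) ^ 2 /
      k ^ (0.75 / ((S.card : ℝ) * Real.log 2) * (1 + gammaMin S ξ)) =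
      2 * (L : ℝ) ^ 2 * (S.card /
        k ^ (0.75 / ((S.card : ℝ) * Real.log 2) * (1 + gammaMin S ξ))) := by ring
  rw [h5, bigXi]
  linarith

theorem tendsto_xiBar {S : Finset (Fin d)} {ξ : ℕ → Fin d → ℝ}
    (hξ : ∀ j ∈ S, Tendsto (fun n => ξ n j) atTop (𝓝 0)) :
    Tendsto (fun n => xiBar S (ξ n)) atTop (𝓝 0) := by
  have h : ∀ j ∈ S, Tendsto (fun n => ((1 + ξ n j)⁻¹ *
      (1 - ξ n j / ((S.card : ℝ) - 1))⁻¹) ^ (1 / (2 * (d : ℝ)))) atTop (𝓝 1) := by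
    intro j hj
    have h1 : Tendsto (fun n => (1 + ξ n j)⁻¹) atTop (𝓝 1) := by
      simpa using ((hξ j hj).const_add 1).inv₀ (by simp)
    have h2 : Tendsto (fun n => (1 - ξ n j / ((S.card : ℝ) - 1))⁻¹) atTop (𝓝 1) := by
      simpa using (((hξ j hj).div_const ((S.card : ℝ) - 1)).const_sub 1).inv₀ (by simp)
    simpa using (h1.mul h2).rpow_const (p := 1 / (2 * (d : ℝ))) (by simp)
  simpa [xiBar] using (tendsto_finsetProd S h).sub_const 1

end Numerical

end RandomForest

namespace RandomForest

/-! ### The regression function -/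

section Regression

variable {d : ℕ} {S : Finset (Fin d)}

theorem strongPart_mem_unitCube {x : EuclideanSpace ℝ (Fin d)} (hx : x ∈ unitCube (Fin d)) :
    strongPart S x ∈ unitCube S := fun j => hx j

theorem continuous_strongPart : Continuous (strongPart S) := by
  unfold strongPart
  fun_prop

/-- A sparse Lipschitz function on the cube has a sparse Lipschitz extension to the whole space. -/
theorem exists_continuous_extension {rstar : EuclideanSpace ℝ S → ℝ} {L : ℝ≥0}
    (hL : LipschitzOnWith L rstar (unitCube S)) :
    ∃ g : EuclideanSpace ℝ (Fin d) → ℝ, Continuous g ∧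
      (∀ x ∈ unitCube (Fin d), g x = rstar (strongPart S x)) ∧
      ∀ x y, (g y - g x) ^ 2 ≤ (L : ℝ) ^ 2 * ∑ j ∈ S, (y j - x j) ^ 2 := by
  obtain ⟨f, hf, hfr⟩ := hL.extend_real
  refine ⟨fun x => f (strongPart S x), hf.continuous.comp continuous_strongPart,
    fun x hx => (hfr (strongPart_mem_unitCube hx)).symm, fun x y => ?_⟩
  have h := hf.dist_le_mul (strongPart S y) (strongPart S x)
  rw [EuclideanSpace.dist_eq, Real.dist_eq] at h
  have h2 := pow_le_pow_left₀ (abs_nonneg _) h 2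
  rw [sq_abs, mul_pow, Real.sq_sqrt (Finset.sum_nonneg fun _ _ => sq_nonneg _)] at h2
  refine h2.trans_eq ?_
  simp_rw [Real.dist_eq, sq_abs, strongPart]
  rw [← Finset.sum_coe_sort S fun j => (y j - x j) ^ 2]

/-- The Lipschitz condition bounds the function on the cube; without boundedness the real supremum
would default to 0. -/
theorem sq_le_supSq {rstar : EuclideanSpace ℝ S → ℝ} {L : ℝ≥0}
    (hL : LipschitzOnWith L rstar (unitCube S)) {x : EuclideanSpace ℝ (Fin d)}
    (hx : x ∈ unitCube (Fin d)) : rstar (strongPart S x) ^ 2 ≤ supSq S rstar := by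
  obtain ⟨g, -, hg, hgL⟩ := exists_continuous_extension hL
  refine le_ciSup (f := fun x : unitCube (Fin d) => rstar (strongPart S x) ^ 2) ?_ ⟨x, hx⟩
  refine ⟨2 * g 0 ^ 2 + 2 * ((L : ℝ) ^ 2 * S.card), ?_⟩
  rintro _ ⟨⟨y, hy⟩, rfl⟩
  have h1 : (L : ℝ) ^ 2 * ∑ j ∈ S, (y j - (0 : EuclideanSpace ℝ (Fin d)) j) ^ 2 ≤
      (L : ℝ) ^ 2 * S.card := by
    refine mul_le_mul_of_nonneg_left ?_ (by positivity)
    refine (Finset.sum_le_card_nsmul S _ 1 fun j _ => ?_).trans_eq (by simp)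
    have := hy j
    simpa using pow_le_one₀ (n := 2) this.1 this.2
  have h2 := hgL 0 y
  simp only [← hg y hy]
  nlinarith [sq_nonneg (g y - 2 * g 0)]

end Regression

/-! ### The error of a single tree -/

section TreeError

variable {d : ℕ}

/-- The residual `y - g x` of a data point `(x, y)` in the cell `A`. -/
noncomputable def cellResidual (A : Set (EuclideanSpace ℝ (Fin d)))
    (g : EuclideanSpace ℝ (Fin d) → ℝ) (z : EuclideanSpace ℝ (Fin d) × ℝ) : ℝ :=
  A.indicator (fun u => z.2 - g u) z.1

/-- Whether the data point `z` falls in the cell `A`, as a number. -/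
noncomputable def cellHit (A : Set (EuclideanSpace ℝ (Fin d)))
    (z : EuclideanSpace ℝ (Fin d) × ℝ) : ℕ :=
  A.indicator (fun _ => 1) z.1

variable {A : Set (EuclideanSpace ℝ (Fin d))} {g : EuclideanSpace ℝ (Fin d) → ℝ}

theorem measurable_cellResidual (hA : MeasurableSet A) (hg : Measurable g) :
    Measurable (cellResidual A g) :=
  (measurable_snd.sub (hg.comp measurable_fst)).indicator (measurable_fst hA)

theorem measurable_cellHit (hA : MeasurableSet A) :
    Measurable (cellHit A) :=
  (measurable_const (a := 1)).indicator (measurable_fst hA)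

theorem cellHit_le_one (z : EuclideanSpace ℝ (Fin d) × ℝ) : cellHit A z ≤ 1 :=
  Set.indicator_le (fun _ _ => le_rfl) _ |>.trans (by simp)

theorem cellResidual_eq_zero (z : EuclideanSpace ℝ (Fin d) × ℝ) (hz : cellHit A z = 0) :
    cellResidual A g z = 0 := by
  simp only [cellHit, Set.indicator_apply_eq_zero, one_ne_zero, imp_false] at hz
  simp [cellResidual, hz]

theorem treeEstimate_error_sq_le {m n : ℕ} {S : Finset (Fin d)} {L M : ℝ}
    (hgL : ∀ x y, (g y - g x) ^ 2 ≤ L ^ 2 * ∑ j ∈ S, (y j - x j) ^ 2) (θ : SplitTree d m)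
    (zs : ℕ → EuclideanSpace ℝ (Fin d) × ℝ) {x : EuclideanSpace ℝ (Fin d)}
    (hx : x ∈ unitCube (Fin d)) (hM : g x ^ 2 ≤ M) :
    (treeEstimate θ (fun i : Fin n => (zs i).1) (fun i : Fin n => (zs i).2) x - g x) ^ 2 ≤
      2 * ((∑ i ∈ Finset.range n, cellResidual (θ.cell x) g (zs i)) /
        ((∑ i ∈ Finset.range n, cellHit (θ.cell x) (zs i) : ℕ) : ℝ)) ^ 2 +
      2 * (L ^ 2 * ∑ j ∈ S, ((θ.box x).hi j - (θ.box x).lo j) ^ 2) +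
      M * if ∑ i ∈ Finset.range n, cellHit (θ.cell x) (zs i) = 0 then 1 else 0 := by
  set N := ∑ i ∈ Finset.range n, cellHit (θ.cell x) (zs i) with hN
  set D := L ^ 2 * ∑ j ∈ S, ((θ.box x).hi j - (θ.box x).lo j) ^ 2 with hD
  have hD0 : 0 ≤ D := mul_nonneg (sq_nonneg _) (Finset.sum_nonneg fun _ _ => sq_nonneg _)
  have hcast : ∀ z : EuclideanSpace ℝ (Fin d) × ℝ,
      (cellHit (θ.cell x) z : ℝ) = (θ.cell x).indicator (fun _ => (1 : ℝ)) z.1 := by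
    intro z
    by_cases h : z.1 ∈ θ.cell x <;> simp [cellHit, h]
  have hcount : cellCount θ (fun i : Fin n => (zs i).1) x = N := by
    rw [hN, cellCount, Nat.cast_sum, ← Fin.sum_univ_eq_sum_range
      fun i => (cellHit (θ.cell x) (zs i) : ℝ)]
    exact Finset.sum_congr rfl fun i _ => (hcast _).symm
  rw [treeEstimate_eq_div, hcount]
  -- On an empty cell the estimate is 0 and the error is `g x ^ 2`, which the last term covers.
  by_cases h0 : N = 0
  · simp only [h0, Nat.cast_zero, div_zero, zero_sub, neg_sq, if_true]
    linarith
  have hN0 : (0 : ℝ) < N := by exact_mod_cast Nat.pos_of_ne_zero h0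
  rw [if_neg h0, mul_zero, add_zero,
    Fin.sum_univ_eq_sum_range fun i => (θ.cell x).indicator (fun _ => (zs i).2) (zs i).1]
  set b : ℝ := (∑ i ∈ Finset.range n, (cellHit (θ.cell x) (zs i) : ℝ) * (g (zs i).1 - g x)) / N
    with hb
  have hdecomp : (∑ i ∈ Finset.range n, (θ.cell x).indicator (fun _ => (zs i).2) (zs i).1) / N -
      g x = (∑ i ∈ Finset.range n, cellResidual (θ.cell x) g (zs i)) / N + b := by
    have h1 : ∑ i ∈ Finset.range n, (θ.cell x).indicator (fun _ => (zs i).2) (zs i).1 =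
        ∑ i ∈ Finset.range n, cellResidual (θ.cell x) g (zs i) +
        ∑ i ∈ Finset.range n, (cellHit (θ.cell x) (zs i) : ℝ) * (g (zs i).1 - g x) + N * g x := by
      rw [hN, Nat.cast_sum, Finset.sum_mul, ← Finset.sum_add_distrib, ← Finset.sum_add_distrib]
      refine Finset.sum_congr rfl fun i _ => ?_
      by_cases h : (zs i).1 ∈ θ.cell x <;> simp [cellHit, cellResidual, h]
    rw [h1, hb]
    field_simp
    ring
  -- `b` averages increments of `g` between points of one cell, each at most `√D` in absolute value.
  have hbD : b ^ 2 ≤ D := by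
    refine Real.sqrt_le_sqrt_iff hD0 |>.1 ?_
    rw [Real.sqrt_sq_eq_abs, hb, abs_div, abs_of_pos hN0, div_le_iff₀ hN0, hN, Nat.cast_sum,
      Finset.mul_sum]
    refine (Finset.abs_sum_le_sum_abs _ _).trans (Finset.sum_le_sum fun i _ => ?_)
    by_cases h : (zs i).1 ∈ θ.cell x
    · rw [abs_mul, abs_of_nonneg (Nat.cast_nonneg _), mul_comm]
      refine mul_le_mul_of_nonneg_right (Real.abs_le_sqrt ((hgL _ _).trans ?_)) (Nat.cast_nonneg _)
      refine mul_le_mul_of_nonneg_left (Finset.sum_le_sum fun j _ => ?_) (sq_nonneg _)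
      rw [← sq_abs]
      exact pow_le_pow_left₀ (abs_nonneg _) (θ.abs_sub_le_side h (θ.mem_cell hx) j) 2
    · simp [cellHit, h]
  rw [hdecomp]
  nlinarith [sq_nonneg ((∑ i ∈ Finset.range n, cellResidual (θ.cell x) g (zs i)) / N - b)]

end TreeError

/-! ### Moments of the residuals -/

section Moments

variable {Ω : Type*} [MeasurableSpace Ω] {P : Measure Ω} {d : ℕ}
  {X : Ω → EuclideanSpace ℝ (Fin d)} {Y : Ω → ℝ} {A : Set (EuclideanSpace ℝ (Fin d))}
  {g : EuclideanSpace ℝ (Fin d) → ℝ}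

theorem map_eq_restrict_of_isUniform (hunif : pdf.IsUniform X (unitCube (Fin d)) P volume) :
    P.map X = volume.restrict (unitCube (Fin d)) := by
  rw [show P.map X = _ from hunif, ProbabilityTheory.cond, volume_unitCube, inv_one, one_smul]

theorem integral_cellHit [IsProbabilityMeasure P] (hX : Measurable X)
    (hunif : pdf.IsUniform X (unitCube (Fin d)) P volume) (hA : MeasurableSet A)
    (hAc : A ⊆ unitCube (Fin d)) :
    ∫ ω, (cellHit A (X ω, Y ω) : ℝ) ∂P = (volume A).toReal := by
  have h : (fun ω => (cellHit A (X ω, Y ω) : ℝ)) = (X ⁻¹' A).indicator fun _ => 1 := by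
    funext ω
    by_cases h : X ω ∈ A <;> simp [cellHit, h]
  rw [h, integral_indicator_const _ (hX hA), smul_eq_mul, mul_one, measureReal_def,
    ← Measure.map_apply hX hA, map_eq_restrict_of_isUniform hunif, Measure.restrict_apply hA,
    Set.inter_eq_left.2 hAc]

theorem cellResidual_pair_eq_indicator {Ω : Type*} (X : Ω → EuclideanSpace ℝ (Fin d))
    (Y : Ω → ℝ) :
    (fun ω => cellResidual A g (X ω, Y ω)) = (X ⁻¹' A).indicator fun ω => Y ω - g (X ω) := by
  funext ω
  by_cases h : X ω ∈ A <;> simp [cellResidual, h]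

theorem memLp_residual (hY2 : MemLp Y 2 P)
    (hg : P[Y | MeasurableSpace.comap X inferInstance] =ᵐ[P] fun ω => g (X ω)) :
    MemLp (fun ω => Y ω - g (X ω)) 2 P :=
  hY2.sub ((memLp_congr_ae hg).1 (hY2.condExp one_le_two))

theorem memLp_cellResidual (hX : Measurable X) (hY2 : MemLp Y 2 P)
    (hg : P[Y | MeasurableSpace.comap X inferInstance] =ᵐ[P] fun ω => g (X ω))
    (hA : MeasurableSet A) : MemLp (fun ω => cellResidual A g (X ω, Y ω)) 2 P := by
  rw [cellResidual_pair_eq_indicator]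
  exact (memLp_residual hY2 hg).indicator (hX hA)

/-- The event that `X` falls in `A` belongs to the σ-algebra of `X`, over which `Y` and its
conditional expectation have the same integral. -/
theorem integral_cellResidual [IsProbabilityMeasure P] (hX : Measurable X) (hY2 : MemLp Y 2 P)
    (hg : P[Y | MeasurableSpace.comap X inferInstance] =ᵐ[P] fun ω => g (X ω))
    (hA : MeasurableSet A) : ∫ ω, cellResidual A g (X ω, Y ω) ∂P = 0 := by
  have hYi := hY2.integrable one_le_two
  rw [cellResidual_pair_eq_indicator, integral_indicator (hX hA),
    integral_sub hYi.integrableOn (integrable_condExp.congr hg).integrableOn,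
    ← setIntegral_condExp hX.comap_le hYi ⟨A, hA, rfl⟩,
    setIntegral_congr_ae (hX hA) (hg.mono fun _ h _ => h), sub_self]

theorem integral_cellResidual_sq_le [IsProbabilityMeasure P] (hX : Measurable X) (hY2 : MemLp Y 2 P)
    (hunif : pdf.IsUniform X (unitCube (Fin d)) P volume)
    (hg : P[Y | MeasurableSpace.comap X inferInstance] =ᵐ[P] fun ω => g (X ω))
    {σ : ℝ} (hvar : Var[Y; P | MeasurableSpace.comap X inferInstance] ≤ᵐ[P] fun _ => σ ^ 2)
    (hA : MeasurableSet A) (hAc : A ⊆ unitCube (Fin d)) :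
    ∫ ω, cellResidual A g (X ω, Y ω) ^ 2 ∂P ≤ σ ^ 2 * (volume A).toReal := by
  have hsq : (fun ω => cellResidual A g (X ω, Y ω) ^ 2) =
      (X ⁻¹' A).indicator fun ω => (Y ω - g (X ω)) ^ 2 := by
    funext ω
    by_cases h : X ω ∈ A <;> simp [cellResidual, h]
  have hint : Integrable ((Y - P[Y | MeasurableSpace.comap X inferInstance]) ^ 2) P :=
    (hY2.sub (hY2.condExp one_le_two)).integrable_sq
  have hmeas : P.real (X ⁻¹' A) = (volume A).toReal := by
    rw [measureReal_def, ← Measure.map_apply hX hA, map_eq_restrict_of_isUniform hunif,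
      Measure.restrict_apply hA, Set.inter_eq_left.2 hAc]
  calc ∫ ω, cellResidual A g (X ω, Y ω) ^ 2 ∂P
      = ∫ ω in X ⁻¹' A, (Y ω - (P[Y | MeasurableSpace.comap X inferInstance]) ω) ^ 2 ∂P := by
        rw [hsq, integral_indicator (hX hA)]
        exact setIntegral_congr_ae (hX hA) (hg.mono fun _ h _ => by rw [h])
    _ = ∫ ω in X ⁻¹' A, (Var[Y; P | MeasurableSpace.comap X inferInstance]) ω ∂P :=
        (setIntegral_condVar (hm := hX.comap_le) hint ⟨A, hA, rfl⟩).symm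
    _ ≤ ∫ _ in X ⁻¹' A, σ ^ 2 ∂P :=
        setIntegral_mono_ae integrable_condVar.integrableOn (integrable_const _).integrableOn hvar
    _ = _ := by
        rw [setIntegral_const, smul_eq_mul, hmeas, mul_comm]

end Moments

/-! ### The error of the forest -/

section ForestError

variable {Ω : Type*} [MeasurableSpace Ω] {P : Measure Ω} [IsProbabilityMeasure P] {d : ℕ}
  {X : Ω → EuclideanSpace ℝ (Fin d)} {Y : Ω → ℝ} {Z : ℕ → Ω → EuclideanSpace ℝ (Fin d) × ℝ}
  {g : EuclideanSpace ℝ (Fin d) → ℝ}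

/-- The variance and empty-cell terms do not depend on the tree, so averaging over `Θ` affects only
the squared sides. A lower integral is used so that Tonelli's theorem applies before integrability
is known. -/
theorem lintegral_forestEstimate_error_le {S : Finset (Fin d)} {L M σ : ℝ} (hX : Measurable X)
    (hZ : ∀ i, Measurable (Z i)) (hiid : iIndepFun Z P)
    (hident : ∀ i, IdentDistrib (Z i) (fun ω => (X ω, Y ω)) P P)
    (hY2 : MemLp Y 2 P) (hunif : pdf.IsUniform X (unitCube (Fin d)) P volume)
    (hgm : Measurable g)
    (hg : P[Y | MeasurableSpace.comap X inferInstance] =ᵐ[P] fun ω => g (X ω))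
    (hvar : Var[Y; P | MeasurableSpace.comap X inferInstance] ≤ᵐ[P] fun _ => σ ^ 2)
    (hgL : ∀ x y, (g y - g x) ^ 2 ≤ L ^ 2 * ∑ j ∈ S, (y j - x j) ^ 2)
    (p : PMF (Fin d)) (k : ℝ) (n : ℕ) {x : EuclideanSpace ℝ (Fin d)}
    (hx : x ∈ unitCube (Fin d)) (hM : g x ^ 2 ≤ M) :
    ∫⁻ ω, ENNReal.ofReal ((forestEstimate p k (fun i : Fin n => (Z i ω).1)
        (fun i : Fin n => (Z i ω).2) x - g x) ^ 2) ∂P ≤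
      ENNReal.ofReal (2 * (2 * σ ^ 2 / ((n + 1) * (1 / 2) ^ depth k)) +
        2 * L ^ 2 * ∑ j ∈ S, (1 - 3 / 4 * (p j).toReal) ^ depth k +
        M * (1 - (1 / 2) ^ depth k) ^ n) := by
  set l : ℝ := (1 / 2) ^ depth k with hl
  have hl0 : 0 < l := by positivity
  have hl1 : l ≤ 1 := pow_le_one₀ (by norm_num) (by norm_num)
  have hvol : ∀ θ : SplitTree d (depth k), (volume (θ.cell x)).toReal = l := fun θ => by
    rw [θ.volume_cell, ENNReal.toReal_ofReal (by positivity)]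
  have hhit : ∀ (θ : SplitTree d (depth k)) (i : ℕ),
      ∫ ω, (cellHit (θ.cell x) (Z i ω) : ℝ) ∂P = l := by
    intro θ i
    have h1 := ((hident i).comp (u := fun z => (cellHit (θ.cell x) z : ℝ))
      ((measurable_of_countable (fun j : ℕ => (j : ℝ))).comp
        (measurable_cellHit (θ.measurableSet_cell x)))).integral_eq
    have h2 := integral_cellHit (Y := Y) hX hunif (θ.measurableSet_cell x) (θ.cell_subset x)
    exact h1.trans (h2.trans (hvol θ))
  have hres : ∀ θ : SplitTree d (depth k), Measurable (cellResidual (θ.cell x) g) := fun θ =>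
    measurable_cellResidual (θ.measurableSet_cell x) hgm
  have hvariance := fun θ : SplitTree d (depth k) =>
    integral_sq_sum_div_count_le (φ := cellResidual (θ.cell x) g) hZ hiid
      (measurable_cellHit (θ.measurableSet_cell x)) cellHit_le_one (hhit θ) hl0 hl1 (hres θ)
      cellResidual_eq_zero
      (fun i => ((hident i).comp (hres θ)).memLp_iff.2
        (memLp_cellResidual hX hY2 hg (θ.measurableSet_cell x)))
      (fun i => ((hident i).comp (hres θ)).integral_eq.trans
        (integral_cellResidual hX hY2 hg (θ.measurableSet_cell x)))
      (sq_nonneg σ)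
      (fun i => ((hident i).comp ((hres θ).pow_const 2)).integral_eq.trans_le
        ((integral_cellResidual_sq_le hX hY2 hunif hg hvar (θ.measurableSet_cell x)
          (θ.cell_subset x)).trans_eq (by rw [hvol])))
      (Finset.range n)
  have hempty : ∀ θ : SplitTree d (depth k),
      ∫ ω, (if ∑ i ∈ Finset.range n, cellHit (θ.cell x) (Z i ω) = 0 then 1 else 0 : ℝ) ∂P =
        (1 - l) ^ n := by
    intro θ
    have h1 := integral_count_eq_binomialMean hZ hiid
      (measurable_cellHit (θ.measurableSet_cell x)) cellHit_le_one (hhit θ) (Finset.range n)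
      (fun j => if j = 0 then 1 else 0) (fun j => by split_ifs <;> simp)
    rwa [binomialMean_indicator_zero, Finset.card_range] at h1
  have hemptyint : ∀ θ : SplitTree d (depth k), Integrable
      (fun ω => (if ∑ i ∈ Finset.range n, cellHit (θ.cell x) (Z i ω) = 0 then 1 else 0 : ℝ)) P := by
    intro θ
    refine Integrable.of_bound (((measurable_of_countable fun j : ℕ =>
      (if j = 0 then 1 else 0 : ℝ)).comp (Finset.measurable_sum _ fun i _ =>
        (measurable_cellHit (θ.measurableSet_cell x)).comp (hZ i))).aestronglyMeasurable) 1
        (.of_forall fun ω => ?_)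
    split_ifs <;> simp
  set W : SplitTree d (depth k) → Ω → ℝ := fun θ ω =>
    2 * ((∑ i ∈ Finset.range n, cellResidual (θ.cell x) g (Z i ω)) /
        ((∑ i ∈ Finset.range n, cellHit (θ.cell x) (Z i ω) : ℕ) : ℝ)) ^ 2 +
      2 * (L ^ 2 * ∑ j ∈ S, ((θ.box x).hi j - (θ.box x).lo j) ^ 2) +
      M * if ∑ i ∈ Finset.range n, cellHit (θ.cell x) (Z i ω) = 0 then 1 else 0 with hW
  have hW1 : ∀ θ : SplitTree d (depth k), Integrable (fun ω => 2 * ((∑ i ∈ Finset.range n,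
      cellResidual (θ.cell x) g (Z i ω)) /
        ((∑ i ∈ Finset.range n, cellHit (θ.cell x) (Z i ω) : ℕ) : ℝ)) ^ 2 +
      2 * (L ^ 2 * ∑ j ∈ S, ((θ.box x).hi j - (θ.box x).lo j) ^ 2)) P := fun θ =>
    ((hvariance θ).1.const_mul 2).add (integrable_const _)
  have hWint : ∀ θ, Integrable (W θ) P := fun θ => (hW1 θ).add ((hemptyint θ).const_mul M)
  have hWle : ∀ θ, ∫ ω, W θ ω ∂P ≤ 2 * (2 * σ ^ 2 / ((n + 1) * l)) +
      2 * (L ^ 2 * ∑ j ∈ S, ((θ.box x).hi j - (θ.box x).lo j) ^ 2) + M * (1 - l) ^ n := by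
    intro θ
    have h1 := (hvariance θ).2
    rw [Finset.card_range] at h1
    rw [hW, integral_add (hW1 θ) ((hemptyint θ).const_mul M),
      integral_add ((hvariance θ).1.const_mul 2) (integrable_const _), integral_const_mul 2,
      integral_const_mul M, hempty, integral_const, probReal_univ, one_smul]
    linarith
  have hpt : ∀ ω, (forestEstimate p k (fun i : Fin n => (Z i ω).1)
      (fun i : Fin n => (Z i ω).2) x - g x) ^ 2 ≤ ∑ θ, treeWeight p θ * W θ ω := by
    intro ω
    have h1 : forestEstimate p k (fun i : Fin n => (Z i ω).1) (fun i : Fin n => (Z i ω).2) x -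
        g x = ∑ θ : SplitTree d (depth k), treeWeight p θ *
          (treeEstimate θ (fun i : Fin n => (Z i ω).1) (fun i : Fin n => (Z i ω).2) x - g x) := by
      simp_rw [forestEstimate_eq_sum, mul_sub, Finset.sum_sub_distrib, ← Finset.sum_mul,
        sum_treeWeight, one_mul]
    rw [h1]
    -- Jensen's inequality for the square, with the tree probabilities as weights.
    refine (Real.pow_arith_mean_le_arith_mean_pow_of_even Finset.univ _ _
      (fun θ _ => treeWeight_nonneg p θ) (sum_treeWeight p _) even_two).trans
      (Finset.sum_le_sum fun θ _ => mul_le_mul_of_nonneg_left ?_ (treeWeight_nonneg p θ))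
    exact treeEstimate_error_sq_le hgL θ (fun i => Z i ω) hx hM
  have hWsum : Integrable (fun ω => ∑ θ, treeWeight p θ * W θ ω) P :=
    integrable_finsetSum _ fun θ _ => (hWint θ).const_mul _
  refine (lintegral_mono fun ω => ENNReal.ofReal_le_ofReal (hpt ω)).trans ?_
  rw [← ofReal_integral_eq_lintegral_ofReal hWsum
    (.of_forall fun ω => (sq_nonneg _).trans (hpt ω)),
    integral_finsetSum _ fun θ _ => (hWint θ).const_mul _]
  refine ENNReal.ofReal_le_ofReal ?_
  calc _ ≤ ∑ θ : SplitTree d (depth k), treeWeight p θ * (2 * (2 * σ ^ 2 / ((n + 1) * l)) +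
        2 * (L ^ 2 * ∑ j ∈ S, ((θ.box x).hi j - (θ.box x).lo j) ^ 2) + M * (1 - l) ^ n) := by
        refine Finset.sum_le_sum fun θ _ => ?_
        rw [integral_const_mul]
        exact mul_le_mul_of_nonneg_left (hWle θ) (treeWeight_nonneg p θ)
    _ = 2 * (2 * σ ^ 2 / ((n + 1) * l)) + 2 * L ^ 2 * ∑ j ∈ S, ∑ θ : SplitTree d (depth k),
          treeWeight p θ * ((θ.box x).hi j - (θ.box x).lo j) ^ 2 + M * (1 - l) ^ n := by
        rw [Finset.sum_comm]
        simp_rw [mul_add, Finset.sum_add_distrib, ← Finset.sum_mul, sum_treeWeight, one_mul,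
          Finset.mul_sum]
        congr 2
        exact Finset.sum_congr rfl fun θ _ => Finset.sum_congr rfl fun j _ => by ring
    _ = _ := by
        simp_rw [SplitTree.box, sum_treeWeight_side_sq]
        simp [Box.root]

end ForestError

end RandomForest

/-! ### Integration over the query point -/

theorem theorem2
    {Ω : Type*} [MeasurableSpace Ω] (P : Measure Ω) [IsProbabilityMeasure P]
    {d : ℕ} (S : Finset (Fin d)) (hS : 2 ≤ S.card)
    -- the generic pair and the training sample
    (X : Ω → EuclideanSpace ℝ (Fin d)) (Y : Ω → ℝ)
    (Xs : ℕ → Ω → EuclideanSpace ℝ (Fin d)) (Ys : ℕ → Ω → ℝ)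
    (hX : Measurable X) (hY : Measurable Y)
    (hXs : ∀ i, Measurable (Xs i)) (hYs : ∀ i, Measurable (Ys i))
    (hiid : iIndepFun (fun i ω => (Xs i ω, Ys i ω)) P)
    (hident : ∀ i, IdentDistrib (fun ω => (Xs i ω, Ys i ω)) (fun ω => (X ω, Y ω)) P P)
    (hgen : IndepFun (fun ω => (X ω, Y ω)) (fun ω i => (Xs i ω, Ys i ω)) P)
    (hY2 : MemLp Y 2 P)
    (hunif : pdf.IsUniform X (unitCube (Fin d)) P volume)
    -- the regression function and its section on the strong coordinates
    (r : EuclideanSpace ℝ (Fin d) → ℝ) (rstar : EuclideanSpace ℝ S → ℝ)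
    (hr : P[Y | MeasurableSpace.comap X inferInstance] =ᵐ[P] fun ω => r (X ω))
    (hsparse : ∀ᵐ x ∂(P.map X), r x = rstar (strongPart S x))
    (L : ℝ≥0) (hL : LipschitzOnWith L rstar (unitCube S))
    (σ : ℝ) (hσ : 0 < σ)
    (hvar : Var[Y; P | MeasurableSpace.comap X inferInstance] ≤ᵐ[P] fun _ => σ ^ 2)
    -- the parameters of the forest
    (k : ℕ → ℝ) (hk : ∀ n, 2 ≤ k n)
    (p : ℕ → PMF (Fin d)) (hp : ∀ n j, (p n j).toReal ∈ Set.Ioo (0 : ℝ) 1)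
    (ξ : ℕ → Fin d → ℝ)
    (hpξ : ∀ n, ∀ j ∈ S, (p n j).toReal = 1 / (S.card : ℝ) * (1 + ξ n j))
    (hξ : ∀ j ∈ S, Tendsto (fun n => ξ n j) atTop (𝓝 0)) :
    (∀ n : ℕ, 1 ≤ n →
      Integrable (fun ω => (forestEstimate (p n) (k n) (fun i : Fin n => Xs i ω)
        (fun i : Fin n => Ys i ω) (X ω) - r (X ω)) ^ 2) P ∧
      ∫ ω, (forestEstimate (p n) (k n) (fun i : Fin n => Xs i ω)
        (fun i : Fin n => Ys i ω) (X ω) - r (X ω)) ^ 2 ∂P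
        ≤ bigXi S rstar σ (ξ n) * (k n / n)
          + 2 * (S.card : ℝ) * (L : ℝ) ^ 2 /
            (k n) ^ (0.75 / ((S.card : ℝ) * Real.log 2) * (1 + gammaMin S (ξ n)))) ∧
    Tendsto (fun n => xiBar S (ξ n)) atTop (𝓝 0) := by
  refine ⟨fun n hn => ?_, tendsto_xiBar hξ⟩
  obtain ⟨g, hgc, hgr, hgL⟩ := exists_continuous_extension hL
  set b : ℝ := 2 * (2 * σ ^ 2 / ((n + 1) * (1 / 2) ^ depth (k n))) +
    2 * (L : ℝ) ^ 2 * ∑ j ∈ S, (1 - 3 / 4 * (p n j).toReal) ^ depth (k n) +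
    supSq S rstar * (1 - (1 / 2) ^ depth (k n)) ^ n with hb
  have hble := fixed_query_bound_le (σ := σ) hS (hk n) (hp n) (hpξ n) rstar L hn
  -- Nonnegativity lets the bound pass from extended nonnegative reals back to reals.
  have hb0 : 0 ≤ b := by
    have hl1 : (1 / 2 : ℝ) ^ depth (k n) ≤ 1 := pow_le_one₀ (by norm_num) (by norm_num)
    have hsup : 0 ≤ supSq S rstar := Real.iSup_nonneg fun _ => sq_nonneg _
    have hq : ∀ j, 0 ≤ 1 - 3 / 4 * (p n j).toReal := fun j => by linarith [(hp n j).2]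
    have h1 : 0 ≤ ∑ j ∈ S, (1 - 3 / 4 * (p n j).toReal) ^ depth (k n) :=
      Finset.sum_nonneg fun j _ => pow_nonneg (hq j) _
    have h2 : 0 ≤ (1 - (1 / 2 : ℝ) ^ depth (k n)) ^ n := pow_nonneg (sub_nonneg.2 hl1) _
    positivity
  have hmap := map_eq_restrict_of_isUniform hunif
  have hcube : ∀ᵐ x ∂(P.map X), x ∈ unitCube (Fin d) := by
    rw [hmap]
    exact ae_restrict_mem (measurableSet_unitCube d)
  -- Off the cube nothing is known of `rstar`, not even measurability; the continuous `g` replaces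
  -- `r` almost surely.
  have hrg : (fun ω => r (X ω)) =ᵐ[P] fun ω => g (X ω) := by
    filter_upwards [ae_of_ae_map hX.aemeasurable hsparse, ae_of_ae_map hX.aemeasurable hcube]
      with ω h1 h2
    rw [h1, hgr _ h2]
  have hZ : ∀ i, Measurable fun ω => (Xs i ω, Ys i ω) := fun i => (hXs i).prodMk (hYs i)
  have hZs : Measurable fun ω i => (Xs i ω, Ys i ω) := measurable_pi_lambda _ hZ
  have hprod : P.map (fun ω => (X ω, fun i => (Xs i ω, Ys i ω))) =
      (P.map X).prod (P.map fun ω i => (Xs i ω, Ys i ω)) :=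
    (indepFun_iff_map_prod_eq_prod_map_map hX.aemeasurable hZs.aemeasurable).1
      (hgen.comp measurable_fst measurable_id)
  have hF := (measurable_forestEstimate (n := n) (p n) (k n)).sub
    (hgc.measurable.comp measurable_fst)
  have hF2 := (hF.pow_const 2).ennreal_ofReal
  -- By independence the joint law of query point and sample is a product, and the inner integral
  -- obeys the fixed-query bound for almost every query point.
  have hlint : ∫⁻ ω, ENNReal.ofReal ((forestEstimate (p n) (k n) (fun i : Fin n => Xs i ω)
      (fun i : Fin n => Ys i ω) (X ω) - g (X ω)) ^ 2) ∂P ≤ ENNReal.ofReal b := by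
    have : IsProbabilityMeasure (P.map X) := Measure.isProbabilityMeasure_map hX.aemeasurable
    have h1 := lintegral_map (μ := P) hF2 (hX.prodMk hZs)
    rw [hprod, lintegral_prod _ hF2.aemeasurable] at h1
    refine h1.symm.le.trans ?_
    have h2 : ∫⁻ _, ENNReal.ofReal b ∂(P.map X) = ENNReal.ofReal b := by simp
    refine (lintegral_mono_ae ?_).trans h2.le
    filter_upwards [hcube] with x hx
    refine (lintegral_map (hF2.comp (measurable_prodMk_left (x := x))) hZs).trans_le ?_
    exact lintegral_forestEstimate_error_le hX hZ hiid hident hY2 hunif hgc.measurable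
      (hr.trans hrg) hvar hgL (p n) (k n) n hx (by rw [hgr x hx]; exact sq_le_supSq hL hx)
  have hmeas : AEStronglyMeasurable (fun ω => (forestEstimate (p n) (k n)
      (fun i : Fin n => Xs i ω) (fun i : Fin n => Ys i ω) (X ω) - g (X ω)) ^ 2) P :=
    ((hF.pow_const 2).comp (hX.prodMk hZs)).aestronglyMeasurable
  have hcongr : (fun ω => (forestEstimate (p n) (k n) (fun i : Fin n => Xs i ω)
      (fun i : Fin n => Ys i ω) (X ω) - r (X ω)) ^ 2) =ᵐ[P]
      fun ω => (forestEstimate (p n) (k n) (fun i : Fin n => Xs i ω)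
        (fun i : Fin n => Ys i ω) (X ω) - g (X ω)) ^ 2 :=
    hrg.mono fun ω h => by simp only [h]
  have hnonneg : 0 ≤ᵐ[P] fun ω => (forestEstimate (p n) (k n) (fun i : Fin n => Xs i ω)
      (fun i : Fin n => Ys i ω) (X ω) - g (X ω)) ^ 2 := .of_forall fun _ => sq_nonneg _
  refine ⟨Integrable.congr ⟨hmeas, ?_⟩ hcongr.symm, ?_⟩
  · rw [hasFiniteIntegral_iff_ofReal hnonneg]
    exact hlint.trans_lt ENNReal.ofReal_lt_top
  · rw [integral_congr_ae hcongr, integral_eq_lintegral_of_nonneg_ae hnonneg hmeas]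
    exact (ENNReal.toReal_le_of_le_ofReal hb0 hlint).trans hble
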